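/- Let $\Omega=(0,1)^2$, let $\varepsilon>0$, and let $N$ be a positive integer divisible by $4$. Put $\lambda=\min\{\varepsilon\ln N,\tfrac14\}$ and let $0=x_0<x_1<\dots<x_N=1$ be the Shishkin mesh obtained by dividing $[0,\lambda]$ into $N/4$, $[\lambda,1-\lambda]$ into $N/2$ and $[1-\lambda,1]$ into $N/4$ equal subintervals. Let $\mathcal T_N$ be the set of the mesh rectangles $K=[x_i,x_{i+1}]\times[x_j,x_{j+1}]$, $0\le i,j<N$. The rectangular Morley space $V_N$ consists of the piecewise polynomial functions $v$ such that * $v|_K\in \mathrm{span}\{1,x,y,x^2,xy,y^2,x^3,y^3\}$ for each $K\in\mathcal T_N$; * $v$ is continuous at each mesh vertex as one moves from one mesh rectangle to another, and $v$ vanishes at the mesh vertices on $\partial\Omega$; * for each edge $e$ of the mesh, $\int_e\left[\frac{\partial v}{\partial n_e}\right]ds=0$, where $[\cdot]$ is the jump across $e$ if $e\not\subset\partial\Omega$, and $\left[\frac{\partial v}{\partial n_e}\right]=\frac{\partial v}{\partial n}$ if $e\subset\partial\Omega$. Let $I_Nv$ be the piecewise bilinear function that agrees with $v$ at all mesh vertices,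 and let $\nabla_N$, $\Delta_N$ be the gradient and the Laplacian applied on the interior of each $K$. For given functions $c$ and $f$ on $\bar\Omega$ write $$b_N(w,v)=\sum_{K\in\mathcal T_N}\int_K c\,\nabla_N w\cdot\nabla_N v\,dx\,dy,\qquad (f,v)=\sum_{K\in\mathcal T_N}\int_K f\,v\,dx\,dy,$$ $$\|v\|_{\varepsilon,N}=\Big(\varepsilon^2\sum_{K\in\mathcal T_N}\|\Delta_N v\|_{L^2(K)}^2+\sum_{K\in\mathcal T_N}\|\nabla_N v\|_{L^2(K)}^2\Big)^{1/2}.$$ Then for every real $M$ there is a constant $C>0$, depending only on $M$ (hence independent of $\varepsilon$, of $N$ and of $\xi_N$), such that the following hold for all $\varepsilon>0$, all positive integers $N$ divisible by $4$, and all $\xi_N\in V_N$. 1. If $c\in C^2(\bar\Omega)$ and $S\in C^4(\bar\Omega)$ (either of which may depend on $\varepsilon$) satisfy $\left|\frac{\partial^{i+j}c}{\partial x^i\partial y^j}\right|\le M$ on $\bar\Omega$ for $0\le i+j\le 2$ and $\left|\frac{\partial^{i+j}S}{\partial x^i\partial y^j}\right|\le M$ on $\bar\Omega$ for $0\le i+j\le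 4$, then $$\left|b_N(S,\xi_N-I_N\xi_N)\right|\le C\,N^{-3/2}\,\|\xi_N\|_{\varepsilon,N}.$$ 2. If $f\in C^1(\bar\Omega)$ (which may depend on $\varepsilon$) satisfies $\left|\frac{\partial^{i+j}f}{\partial x^i\partial y^j}\right|\le M$ on $\bar\Omega$ for $0\le i+j\le 1$, then $$\left|(f,\xi_N-I_N\xi_N)\right|\le C\,N^{-3/2}\,\|\xi_N\|_{\varepsilon,N}.$$ -/

import Mathlib

open MeasureTheory Set

noncomputable section

namespace Morley

/-! ### The domain, partial derivatives, and smooth functions with bounds -/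

/-- The open unit square `Ω = (0,1)²`. -/
def Om : Set (ℝ × ℝ) := Ioo 0 1 ×ˢ Ioo 0 1

/-- The closed unit square. -/
def OmBar : Set (ℝ × ℝ) := Icc 0 1 ×ˢ Icc 0 1

/-- The partial derivative `∂g/∂x`. -/
def dx (g : ℝ × ℝ → ℝ) (p : ℝ × ℝ) : ℝ := deriv (fun t => g (t, p.2)) p.1

/-- The partial derivative `∂g/∂y`. -/
def dy (g : ℝ × ℝ → ℝ) (p : ℝ × ℝ) : ℝ := deriv (fun t => g (p.1, t)) p.2

/-- The Laplacian. -/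
def lap (g : ℝ × ℝ → ℝ) (p : ℝ × ℝ) : ℝ := dx (dx g) p + dy (dy g) p

/-- `g ∈ C^k(Ω̄)` and every partial derivative `∂^{i+j} g / ∂x^i ∂y^j` with `0 ≤ i + j ≤ k`
is bounded by `M`. The bound is written on the open square, where the two-sided partial
derivatives exist; as `g ∈ C^k(Ω̄)`, it holds on the closed square as well, by continuity. -/
def CkBound (k : ℕ) (g : ℝ × ℝ → ℝ) (M : ℝ) : Prop :=
  ContDiffOn ℝ k g OmBar ∧
    ∀ i j : ℕ, i + j ≤ k → ∀ p ∈ Om, |(dx^[i] (dy^[j] g)) p| ≤ M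

/-! ### The Shishkin mesh -/

/-- The transition parameter `λ = min {ε ln N, 1/4}`. -/
def lam (ε : ℝ) (N : ℕ) : ℝ := min (ε * Real.log N) (1 / 4)

/-- The nodes `x_0, …, x_N` of the one-dimensional Shishkin mesh: `[0,λ]`, `[λ,1-λ]`, `[1-λ,1]`
are divided into `N/4`, `N/2`, `N/4` equal subintervals. -/
def node (ε : ℝ) (N : ℕ) (i : ℕ) : ℝ :=
  if 4 * i ≤ N then i * (lam ε N / (N / 4))
  else if 4 * i ≤ 3 * N then
    lam ε N + ((i : ℝ) - N / 4) * ((1 - 2 * lam ε N) / (N / 2))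
  else (1 - lam ε N) + ((i : ℝ) - 3 * N / 4) * (lam ε N / (N / 4))

/-! ### Piecewise functions on the tensor-product mesh with nodes `X i` in both directions

The mesh rectangles are `K i j = [X i, X (i+1)] × [X j, X (j+1)]` for `i, j < N`.
A piecewise function is given by the family of its restrictions: `v i j` is the function on
`K i j` (only `i, j < N` matter). For piecewise polynomials `v i j` is the polynomial itself,
so it can be evaluated on the whole of `∂K`; differential operators act piecewise.
A function `w` on all of `Ω` is the family `fun _ _ => w`. -/

/-- A piecewise function. -/
abbrev Broken : Type := ℕ → ℕ → ℝ × ℝ → ℝ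

/-- The interior of the mesh rectangle `K i j`. -/
def cell (X : ℕ → ℝ) (i j : ℕ) : Set (ℝ × ℝ) :=
  Ioo (X i) (X (i + 1)) ×ˢ Ioo (X j) (X (j + 1))

/-- The four vertices of the mesh rectangle `K i j`. -/
def vertices (X : ℕ → ℝ) (i j : ℕ) : Set (ℝ × ℝ) :=
  {X i, X (i + 1)} ×ˢ {X j, X (j + 1)}

/-- The space `P(K) = span {1, x, y, x², xy, y², x³, y³}`. -/
def IsMorleyPoly (p : ℝ × ℝ → ℝ) : Prop :=
  ∃ a : Fin 8 → ℝ, ∀ x y : ℝ, p (x, y) =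
    a 0 + a 1 * x + a 2 * y + a 3 * x ^ 2 + a 4 * (x * y) + a 5 * y ^ 2 + a 6 * x ^ 3 + a 7 * y ^ 3

/-- The integral of `∂v/∂x` along the vertical segment `{x} × [X j, X (j+1)]`. -/
def vertFlux (X : ℕ → ℝ) (v : ℝ × ℝ → ℝ) (x : ℝ) (j : ℕ) : ℝ :=
  ∫ y in (X j)..(X (j + 1)), dx v (x, y)

/-- The integral of `∂v/∂y` along the horizontal segment `[X i, X (i+1)] × {y}`. -/
def horFlux (X : ℕ → ℝ) (v : ℝ × ℝ → ℝ) (i : ℕ) (y : ℝ) : ℝ :=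
  ∫ x in (X i)..(X (i + 1)), dy v (x, y)

/-- The rectangular Morley element space `V_N`. -/
structure IsMorley (X : ℕ → ℝ) (N : ℕ) (v : Broken) : Prop where
  /-- `v|_K ∈ P(K)` for each mesh rectangle. -/
  poly : ∀ i < N, ∀ j < N, IsMorleyPoly (v i j)
  /-- `v` is continuous at the mesh vertices as one moves from one rectangle to another. -/
  vertex_cont : ∀ i < N, ∀ j < N, ∀ i' < N, ∀ j' < N,
    ∀ p ∈ vertices X i j ∩ vertices X i' j', v i j p = v i' j' p
  /-- `v` vanishes at the vertices on `∂Ω`. -/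
  vertex_bdry : ∀ i < N, ∀ j < N, ∀ p ∈ vertices X i j, p ∉ Om → v i j p = 0
  /-- The jump of the normal derivative has zero integral over each interior vertical edge. -/
  edge_vert : ∀ i, i + 1 < N → ∀ j < N,
    vertFlux X (v (i + 1) j) (X (i + 1)) j - vertFlux X (v i j) (X (i + 1)) j = 0
  /-- The same over each interior horizontal edge. -/
  edge_hor : ∀ i < N, ∀ j, j + 1 < N →
    horFlux X (v i (j + 1)) i (X (j + 1)) - horFlux X (v i j) i (X (j + 1)) = 0
  /-- The normal derivative has zero integral over each edge on the side `x = 0` of `Ω`. -/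
  edge_left : ∀ j < N, vertFlux X (v 0 j) (X 0) j = 0
  /-- The same on the side `x = 1`. -/
  edge_right : ∀ j < N, vertFlux X (v (N - 1) j) (X N) j = 0
  /-- The same on the side `y = 0`. -/
  edge_bottom : ∀ i < N, horFlux X (v i 0) i (X 0) = 0
  /-- The same on the side `y = 1`. -/
  edge_top : ∀ i < N, horFlux X (v i (N - 1)) i (X N) = 0

/-- The bilinear function that agrees with `g` at the vertices of `[a,b] × [c,d]`. -/
def bilin (a b c d : ℝ) (g : ℝ × ℝ → ℝ) (p : ℝ × ℝ) : ℝ :=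
  (g (a, c) * (b - p.1) * (d - p.2) + g (b, c) * (p.1 - a) * (d - p.2)
    + g (a, d) * (b - p.1) * (p.2 - c) + g (b, d) * (p.1 - a) * (p.2 - c))
    / ((b - a) * (d - c))

/-- The piecewise bilinear nodal interpolant `I_N v`. -/
def interp (X : ℕ → ℝ) (v : Broken) : Broken :=
  fun i j => bilin (X i) (X (i + 1)) (X j) (X (j + 1)) (v i j)

/-- `∑_K ∫_K g`, for a piecewise function `g`. -/
def meshIntegral (X : ℕ → ℝ) (N : ℕ) (g : Broken) : ℝ :=
  ∑ i ∈ Finset.range N, ∑ j ∈ Finset.range N, ∫ p in cell X i j, g i j p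

/-- `b_N(w, v) = (c ∇_N w, ∇_N v)`. -/
def bForm (X : ℕ → ℝ) (N : ℕ) (c : ℝ × ℝ → ℝ) (w v : Broken) : ℝ :=
  meshIntegral X N fun i j p =>
    c p * (dx (w i j) p * dx (v i j) p + dy (w i j) p * dy (v i j) p)

/-- The `L²(Ω)` inner product `(f, v)`. -/
def l2Form (X : ℕ → ℝ) (N : ℕ) (f : ℝ × ℝ → ℝ) (v : Broken) : ℝ :=
  meshIntegral X N fun i j p => f p * v i j p

/-- `|v|_{1,N}² = (∇_N v, ∇_N v)`. -/
def semi1Sq (X : ℕ → ℝ) (N : ℕ) (v : Broken) : ℝ :=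
  meshIntegral X N fun i j p => dx (v i j) p ^ 2 + dy (v i j) p ^ 2

/-- `|v|_{2,N}² = (Δ_N v, Δ_N v)`. -/
def semi2Sq (X : ℕ → ℝ) (N : ℕ) (v : Broken) : ℝ :=
  meshIntegral X N fun i j p => lap (v i j) p ^ 2

/-- `‖v‖_{ε,N} = (ε² |v|_{2,N}² + |v|_{1,N}²)^{1/2}`. -/
def energyNorm (X : ℕ → ℝ) (N : ℕ) (ε : ℝ) (v : Broken) : ℝ :=
  Real.sqrt (ε ^ 2 * semi2Sq X N v + semi1Sq X N v)

end Morley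

end

/-! On a cell, bilinear interpolation reproduces `1, x, y, xy`, and the remaining monomials of
`P(K)` depend on one variable. Hence `ξ - I_N ξ` is a cubic in `x` vanishing on the two vertical
edges plus a cubic in `y` vanishing on the two horizontal ones (`morleyPoly_sub_bilin`). Swapping
the coordinates reduces everything to the first summand, `bub`.

The integral of `bub` over an interval of length `h` is `-h²/12` times the increment of `∂ξ/∂x`
between the end points (`integral_bub`), and this increment may be taken between the means of
`∂ξ/∂x` over the two vertical edges. The Morley conditions say that these means agree across
interior edges and vanish on the boundary. So, along a horizontal strip, a load `G` may be frozen at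
the cell midpoints and the sum of `h²/12 · G · (increment)` summed by parts: the difference then
falls on `h² G`. Between equal cells it is `O(h³)`, which contributes order `N⁻²` in total. Only at
the two transition points does it stay `O(h²)`; a single edge mean is controlled by `h^(-1/2)` times
the `L²` norm on the strip, and this gives `N^(-3/2)`. This is `abs_sum_integral_mul_bub_le`;
integration over the strips is `abs_meshIntegral_mul_bub_le`.

The form `b_N` becomes a load term by integrating by parts on each cell (`integral_mul_bubDeriv`):
no boundary term arises, because `bub` vanishes there. Only the first-order part of the energy norm
enters, so the constants do not depend on `ε`. -/

namespace Morley

/-! ### One-dimensional estimates -/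

/-- The cubic vanishing at `a` and `b` that is the interpolation error of `s x² + t x³`. -/
def bub (a b s t x : ℝ) : ℝ := (x - a) * (x - b) * (s + t * (x + a + b))

/-- The derivative of `bub`. -/
def bubDeriv (a b s t x : ℝ) : ℝ :=
  2 * s * x + 3 * t * x ^ 2 - (s * (a + b) + t * (a ^ 2 + a * b + b ^ 2))

/-- The quadratic `p + 2 s x + 3 t x²`. -/
def quad (p s t x : ℝ) : ℝ := p + 2 * s * x + 3 * t * x ^ 2

theorem hasDerivAt_bub (a b s t x : ℝ) : HasDerivAt (bub a b s t) (bubDeriv a b s t x) x := by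
  have h : HasDerivAt (fun x : ℝ => s * x ^ 2 + t * x ^ 3
      - x * (s * (a + b) + t * (a ^ 2 + a * b + b ^ 2)) + (s * a * b + t * (a * b * (a + b))))
      (s * (2 * x) + t * (3 * x ^ 2)
        - 1 * (s * (a + b) + t * (a ^ 2 + a * b + b ^ 2))) x := by
    have h2 : HasDerivAt (fun x : ℝ => x ^ 2) (2 * x) x := by simpa using hasDerivAt_pow 2 x
    have h3 : HasDerivAt (fun x : ℝ => x ^ 3) (3 * x ^ 2) x := by simpa using hasDerivAt_pow 3 x
    exact (((h2.const_mul s).add (h3.const_mul t)).sub ((hasDerivAt_id x).mul_const _)).add_const _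
  convert h using 1
  · funext x; unfold bub; ring
  · unfold bubDeriv; ring

theorem continuous_bub (a b s t : ℝ) : Continuous (bub a b s t) := by
  unfold bub; fun_prop

theorem continuous_bubDeriv (a b s t : ℝ) : Continuous (bubDeriv a b s t) := by
  unfold bubDeriv; fun_prop

theorem continuous_quad (p s t : ℝ) : Continuous (quad p s t) := by
  unfold quad; fun_prop

theorem integral_Ioo_eq_interval {a b : ℝ} (hab : a ≤ b) (g : ℝ → ℝ) :
    ∫ x in Ioo a b, g x = ∫ x in a..b, g x := by
  rw [intervalIntegral.integral_of_le hab, integral_Ioc_eq_integral_Ioo]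

theorem integral_of_primitive {g G : ℝ → ℝ} (hg : Continuous g)
    (hG : ∀ x, HasDerivAt G (g x) x) {a b : ℝ} (hab : a ≤ b) :
    ∫ x in Ioo a b, g x = G b - G a := by
  rw [integral_Ioo_eq_interval hab]
  exact intervalIntegral.integral_eq_sub_of_hasDerivAt (fun x _ => hG x)
    (hg.intervalIntegrable _ _)

theorem integral_quartic {a b : ℝ} (hab : a ≤ b) (c₀ c₁ c₂ c₃ c₄ : ℝ) :
    ∫ x in Ioo a b, (c₀ + c₁ * x + c₂ * x ^ 2 + c₃ * x ^ 3 + c₄ * x ^ 4) =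
      c₀ * (b - a) + c₁ * (b ^ 2 - a ^ 2) / 2 + c₂ * (b ^ 3 - a ^ 3) / 3
        + c₃ * (b ^ 4 - a ^ 4) / 4 + c₄ * (b ^ 5 - a ^ 5) / 5 := by
  rw [integral_of_primitive (G := fun x => c₀ * x + c₁ * (x ^ 2 / 2) + c₂ * (x ^ 3 / 3)
    + c₃ * (x ^ 4 / 4) + c₄ * (x ^ 5 / 5)) (by fun_prop) _ hab]
  · ring
  · intro x
    have h2 : HasDerivAt (fun x : ℝ => x ^ 2 / 2) x x := by
      simpa using (hasDerivAt_pow 2 x).div_const 2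
    have h3 : HasDerivAt (fun x : ℝ => x ^ 3 / 3) (x ^ 2) x := by
      simpa using (hasDerivAt_pow 3 x).div_const 3
    have h4 : HasDerivAt (fun x : ℝ => x ^ 4 / 4) (x ^ 3) x := by
      simpa using (hasDerivAt_pow 4 x).div_const 4
    have h5 : HasDerivAt (fun x : ℝ => x ^ 5 / 5) (x ^ 4) x := by
      simpa using (hasDerivAt_pow 5 x).div_const 5
    have := (((((hasDerivAt_id x).const_mul c₀).add (h2.const_mul c₁)).add (h3.const_mul c₂)).add
      (h4.const_mul c₃)).add (h5.const_mul c₄)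
    exact this.congr_deriv (by ring)

/-- The constant `p` cancels in the increment, so it is free. Later it is chosen so that `quad`
becomes the edge mean of the derivative, which is the quantity that matches between cells. -/
theorem integral_bub {a b : ℝ} (hab : a ≤ b) (p s t : ℝ) :
    ∫ x in Ioo a b, bub a b s t x = -((b - a) ^ 2 / 12) * (quad p s t b - quad p s t a) := by
  have h : ∀ x, bub a b s t x = (s * a * b + t * (a * b * (a + b)))
      + (-(s * (a + b) + t * (a ^ 2 + a * b + b ^ 2))) * x + s * x ^ 2 + t * x ^ 3
      + 0 * x ^ 4 := fun x => by unfold bub; ring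
  simp_rw [h]
  rw [integral_quartic hab]
  unfold quad; ring

/-- The root mean square of a quadratic over an interval. -/
noncomputable def rms (a b p s t : ℝ) : ℝ := Real.sqrt ((∫ x in Ioo a b, quad p s t x ^ 2) / (b - a))

theorem rms_nonneg (a b p s t : ℝ) : 0 ≤ rms a b p s t := Real.sqrt_nonneg _

theorem rms_sq {a b : ℝ} (hab : a < b) (p s t : ℝ) :
    (b - a) * rms a b p s t ^ 2 = ∫ x in Ioo a b, quad p s t x ^ 2 := by
  rw [rms, Real.sq_sqrt]
  · field_simp [(sub_pos.2 hab).ne']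
  · exact div_nonneg (integral_nonneg fun x => sq_nonneg _) (sub_pos.2 hab).le

/-- The root mean square in terms of the Legendre coefficients. -/
theorem rms_sq_eq {a b : ℝ} (hab : a < b) (p s t : ℝ) :
    rms a b p s t ^ 2 = (quad p s t ((a + b) / 2) + t * (b - a) ^ 2 / 4) ^ 2
      + ((2 * s + 3 * t * (a + b)) * (b - a)) ^ 2 / 12 + (3 * t * (b - a) ^ 2) ^ 2 / 180 := by
  have hne : b - a ≠ 0 := (sub_pos.2 hab).ne'
  apply mul_left_cancel₀ hne
  rw [rms_sq hab]
  have h : ∀ x, quad p s t x ^ 2 = p ^ 2 + (4 * p * s) * x + (4 * s ^ 2 + 6 * p * t) * x ^ 2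
      + (12 * s * t) * x ^ 3 + (9 * t ^ 2) * x ^ 4 := fun x => by unfold quad; ring
  simp_rw [h]
  rw [integral_quartic hab.le]
  unfold quad; ring

theorem abs_quad_right_le {a b : ℝ} (hab : a < b) (p s t : ℝ) :
    |quad p s t b| ≤ 3 * rms a b p s t := by
  apply abs_le_of_sq_le_sq _ (by have := rms_nonneg a b p s t; positivity)
  rw [mul_pow, rms_sq_eq hab]
  have h : quad p s t b = (quad p s t ((a + b) / 2) + t * (b - a) ^ 2 / 4)
    + ((2 * s + 3 * t * (a + b)) * (b - a)) / 2 + (3 * t * (b - a) ^ 2) / 6 := by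
    unfold quad; ring
  rw [h]
  generalize quad p s t ((a + b) / 2) + t * (b - a) ^ 2 / 4 = A
  generalize (2 * s + 3 * t * (a + b)) * (b - a) = D
  generalize 3 * t * (b - a) ^ 2 = G
  -- Cauchy-Schwarz for the Legendre coefficients: `(A + D/2 + G/6)² ≤ (1 + 3 + 5)(A² + D²/12 +
  -- G²/180)`, whence the factor `3`.
  nlinarith [sq_nonneg (6 * A - D), sq_nonneg (30 * A - G), sq_nonneg (5 * D - G)]

theorem abs_quad_left_le {a b : ℝ} (hab : a < b) (p s t : ℝ) :
    |quad p s t a| ≤ 3 * rms a b p s t := by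
  apply abs_le_of_sq_le_sq _ (by have := rms_nonneg a b p s t; positivity)
  rw [mul_pow, rms_sq_eq hab]
  have h : quad p s t a = (quad p s t ((a + b) / 2) + t * (b - a) ^ 2 / 4)
    - ((2 * s + 3 * t * (a + b)) * (b - a)) / 2 + (3 * t * (b - a) ^ 2) / 6 := by
    unfold quad; ring
  rw [h]
  generalize quad p s t ((a + b) / 2) + t * (b - a) ^ 2 / 4 = A
  generalize (2 * s + 3 * t * (a + b)) * (b - a) = D
  generalize 3 * t * (b - a) ^ 2 = G
  nlinarith [sq_nonneg (6 * A + D), sq_nonneg (30 * A - G), sq_nonneg (5 * D + G)]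

/-- The factor `(x - a)(x - b)` is at most `(b - a)²/4`, and the other factor is a combination of
the first and second Legendre coefficients of `quad`, each bounded by the root mean square. -/
theorem abs_bub_le {a b x : ℝ} (hab : a < b) (hx : x ∈ Icc a b) (p s t : ℝ) :
    |bub a b s t x| ≤ (b - a) * rms a b p s t := by
  have hE := rms_nonneg a b p s t
  have hsq := rms_sq_eq hab p s t
  set E := rms a b p s t
  have hh : 0 < b - a := sub_pos.2 hab
  -- The constants `7/2` and `27/2` round up `√12` and `√180`. They give `7/4 + 9/4 = 4` in `h4`,
  -- which cancels the `1/4` of `h3`.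
  have h1 : |(2 * s + 3 * t * (a + b)) * (b - a)| ≤ 7 / 2 * E := by
    apply abs_le_of_sq_le_sq _ (by positivity)
    nlinarith [sq_nonneg (quad p s t ((a + b) / 2) + t * (b - a) ^ 2 / 4),
      sq_nonneg (3 * t * (b - a) ^ 2)]
  have h2 : |3 * t * (b - a) ^ 2| ≤ 27 / 2 * E := by
    apply abs_le_of_sq_le_sq _ (by positivity)
    nlinarith [sq_nonneg (quad p s t ((a + b) / 2) + t * (b - a) ^ 2 / 4),
      sq_nonneg ((2 * s + 3 * t * (a + b)) * (b - a))]
  have h3 : |(x - a) * (x - b)| ≤ (b - a) ^ 2 / 4 := by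
    rw [abs_le]
    constructor
    · nlinarith [sq_nonneg (2 * x - a - b)]
    · nlinarith [mul_nonneg (sub_nonneg.2 hx.1) (sub_nonneg.2 hx.2), sq_nonneg (b - a)]
  have h4 : |(s + t * (x + a + b)) * (b - a)| ≤ 4 * E := by
    have h5 : |t * (b - a) * (x - (a + b) / 2)| ≤ 9 / 4 * E := by
      have : |x - (a + b) / 2| ≤ (b - a) / 2 := by
        rw [abs_le]; constructor <;> linarith [hx.1, hx.2]
      calc |t * (b - a) * (x - (a + b) / 2)| = |t * (b - a)| * |x - (a + b) / 2| := abs_mul _ _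
        _ ≤ |t * (b - a)| * ((b - a) / 2) := by gcongr
        _ = |3 * t * (b - a) ^ 2| / 6 := by
          rw [show 3 * t * (b - a) ^ 2 = t * (b - a) * (3 * (b - a)) by ring, abs_mul _ (3 * _),
            abs_of_pos (show 0 < 3 * (b - a) by positivity)]
          ring
        _ ≤ 9 / 4 * E := by linarith
    rw [show (s + t * (x + a + b)) * (b - a) = (2 * s + 3 * t * (a + b)) * (b - a) / 2
      + t * (b - a) * (x - (a + b) / 2) by ring]
    rw [abs_le] at h1 h5 ⊢
    constructor <;> linarith [h1.1, h1.2, h5.1, h5.2]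
  have h6 : |bub a b s t x| * (b - a) ≤ (b - a) ^ 2 * E := by
    calc |bub a b s t x| * (b - a)
        = |(x - a) * (x - b)| * |(s + t * (x + a + b)) * (b - a)| := by
          rw [bub, abs_mul, abs_mul _ (b - a), abs_of_pos hh]; ring
      _ ≤ (b - a) ^ 2 / 4 * (4 * E) := by gcongr
      _ = (b - a) ^ 2 * E := by ring
  nlinarith

/-- Replacing `G` by its midpoint value in `∫ G bub`. -/
theorem abs_integral_mul_bub_sub_le {a b B : ℝ} (hab : a < b) {G : ℝ → ℝ}
    (hB : 0 ≤ B) (hG : ∀ x ∈ Ioo a b, ∀ y ∈ Ioo a b, |G x - G y| ≤ B * |x - y|) (p s t : ℝ) :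
    |(∫ x in Ioo a b, G x * bub a b s t x)
        + (b - a) ^ 2 / 12 * G ((a + b) / 2) * (quad p s t b - quad p s t a)|
      ≤ B * (b - a) ^ 3 * rms a b p s t := by
  have hh : 0 < b - a := sub_pos.2 hab
  have hE := rms_nonneg a b p s t
  have hm : (a + b) / 2 ∈ Ioo a b := ⟨by linarith, by linarith⟩
  have hbound : ∀ x ∈ Ioo a b, ‖(G x - G ((a + b) / 2)) * bub a b s t x‖
      ≤ B * (b - a) * ((b - a) * rms a b p s t) := by
    intro x hx
    rw [norm_mul, Real.norm_eq_abs, Real.norm_eq_abs]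
    have h1 : |x - (a + b) / 2| ≤ b - a := by
      rw [abs_le]; constructor <;> linarith [hx.1, hx.2]
    exact mul_le_mul ((hG x hx _ hm).trans (by gcongr))
      (abs_bub_le hab (Ioo_subset_Icc_self hx) p s t) (abs_nonneg _) (by positivity)
  have hGc : ContinuousOn G (Ioo a b) := by
    have : LipschitzOnWith B.toNNReal G (Ioo a b) := by
      apply LipschitzOnWith.of_dist_le_mul
      intro x hx y hy
      rw [Real.dist_eq, Real.dist_eq, Real.coe_toNNReal _ hB]
      exact hG x hx y hy
    exact this.continuousOn
  have hvol : volume (Ioo a b) < ⊤ := by simp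
  have hint : IntegrableOn (fun x => (G x - G ((a + b) / 2)) * bub a b s t x) (Ioo a b) :=
    IntegrableOn.of_bound hvol
      (((hGc.sub continuousOn_const).mul (continuous_bub a b s t).continuousOn).aestronglyMeasurable
        measurableSet_Ioo) _ ((ae_restrict_iff' measurableSet_Ioo).2 (ae_of_all _ hbound))
  have hint' : IntegrableOn (fun x => G ((a + b) / 2) * bub a b s t x) (Ioo a b) :=
    ((continuous_const.mul (continuous_bub a b s t)).integrableOn_Icc).mono_set Ioo_subset_Icc_self
  have hsplit : ∫ x in Ioo a b, G x * bub a b s t x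
      = (∫ x in Ioo a b, (G x - G ((a + b) / 2)) * bub a b s t x)
        + ∫ x in Ioo a b, G ((a + b) / 2) * bub a b s t x := by
    rw [← integral_add hint hint']
    congr 1; funext x; ring
  rw [hsplit, integral_const_mul, integral_bub hab.le p]
  have := norm_setIntegral_le_of_norm_le_const (μ := volume) hvol hbound
  rw [Real.norm_eq_abs, measureReal_def, Real.volume_Ioo, ENNReal.toReal_ofReal hh.le] at this
  convert this using 1
  · congr 1; ring
  · ring

/-- Summation by parts with vanishing end values. -/
theorem sum_mul_diff (c F : ℕ → ℝ) (n : ℕ) :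
    ∑ i ∈ Finset.range (n + 1), c i * (F (i + 1) - F i)
      = c n * F (n + 1) - c 0 * F 0
        - ∑ i ∈ Finset.range n, F (i + 1) * (c (i + 1) - c i) := by
  induction n with
  | zero => simp; ring
  | succ n ih => rw [Finset.sum_range_succ, ih, Finset.sum_range_succ _ n]; ring

/-- The weighted Cauchy-Schwarz inequality. -/
theorem sum_weight_mul_le {ι : Type*} (I : Finset ι) (w e : ι → ℝ) (hw : ∀ i ∈ I, 0 ≤ w i)
    (hW : ∑ i ∈ I, w i ≤ 1) : ∑ i ∈ I, w i * e i ≤ Real.sqrt (∑ i ∈ I, w i * e i ^ 2) := by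
  apply Real.le_sqrt_of_sq_le
  have h := Finset.sum_mul_sq_le_sq_mul_sq I (fun i => Real.sqrt (w i))
    (fun i => Real.sqrt (w i) * e i)
  have h1 : ∑ i ∈ I, Real.sqrt (w i) * (Real.sqrt (w i) * e i) = ∑ i ∈ I, w i * e i :=
    Finset.sum_congr rfl fun i hi => by rw [← mul_assoc, Real.mul_self_sqrt (hw i hi)]
  have h2 : ∑ i ∈ I, Real.sqrt (w i) ^ 2 = ∑ i ∈ I, w i :=
    Finset.sum_congr rfl fun i hi => Real.sq_sqrt (hw i hi)
  have h3 : ∑ i ∈ I, (Real.sqrt (w i) * e i) ^ 2 = ∑ i ∈ I, w i * e i ^ 2 :=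
    Finset.sum_congr rfl fun i hi => by rw [mul_pow, Real.sq_sqrt (hw i hi)]
  rw [h1, h2, h3] at h
  refine h.trans (mul_le_of_le_one_left (Finset.sum_nonneg fun i hi => ?_) hW)
  exact mul_nonneg (hw i hi) (sq_nonneg _)

/-- A mesh on `[0,1]` with steps at most `2 δ²` that is uniform except at the nodes `n` and `m`,
where the coarser cell lies between these nodes. -/
structure IsTwoJumpMesh (X : ℕ → ℝ) (N n m : ℕ) (δ : ℝ) : Prop where
  left : X 0 = 0
  right : X N = 1
  lt : ∀ i < N, X i < X (i + 1)
  step_le : ∀ i < N, X (i + 1) - X i ≤ 2 * δ ^ 2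
  uniform : ∀ i, i + 1 < N → i + 1 ≠ n → i + 1 ≠ m → X (i + 2) - X (i + 1) = X (i + 1) - X i
  jump_left : ∀ i, i + 1 = n → X (i + 1) - X i ≤ X (i + 2) - X (i + 1)
  jump_right : ∀ i, i + 1 = m → X (i + 2) - X (i + 1) ≤ X (i + 1) - X i

namespace IsTwoJumpMesh

variable {X : ℕ → ℝ} {N n m : ℕ} {δ : ℝ}

theorem nonneg (hX : IsTwoJumpMesh X N n m δ) {i : ℕ} (hi : i ≤ N) : 0 ≤ X i := by
  induction i with
  | zero => exact hX.left.ge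
  | succ i ih => exact (ih (by omega)).trans (hX.lt i (by omega)).le

theorem le_one (hX : IsTwoJumpMesh X N n m δ) {i : ℕ} (hi : i ≤ N) : X i ≤ 1 := by
  induction hi using Nat.decreasingInduction with
  | self => exact hX.right.le
  | of_succ i hi ih => exact (hX.lt i hi).le.trans ih

theorem Ioo_subset (hX : IsTwoJumpMesh X N n m δ) {i : ℕ} (hi : i < N) :
    Ioo (X i) (X (i + 1)) ⊆ Ioo 0 1 :=
  Ioo_subset_Ioo (hX.nonneg hi.le) (hX.le_one hi)

theorem cell_subset (hX : IsTwoJumpMesh X N n m δ) {i j : ℕ} (hi : i < N) (hj : j < N) :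
    cell X i j ⊆ Om :=
  Set.prod_mono (hX.Ioo_subset hi) (hX.Ioo_subset hj)

theorem sum_step (hX : IsTwoJumpMesh X N n m δ) :
    ∑ i ∈ Finset.range N, (X (i + 1) - X i) = 1 := by
  rw [Finset.sum_range_sub, hX.left, hX.right, sub_zero]

end IsTwoJumpMesh

/-- The one-dimensional estimate on a strip. -/
theorem abs_sum_integral_mul_bub_le {X : ℕ → ℝ} {N n m : ℕ} {δ B : ℝ}
    (hX : IsTwoJumpMesh X N n m δ) (hN : 0 < N) (hδ : 0 ≤ δ) (hδ1 : δ ≤ 1)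
    (hB : 0 ≤ B) {G : ℝ → ℝ} (hG0 : ∀ x ∈ Ioo (0 : ℝ) 1, |G x| ≤ B)
    (hG : ∀ x ∈ Ioo (0 : ℝ) 1, ∀ y ∈ Ioo (0 : ℝ) 1, |G x - G y| ≤ B * |x - y|)
    (p s t : ℕ → ℝ)
    (hcont : ∀ i, i + 1 < N →
      quad (p (i + 1)) (s (i + 1)) (t (i + 1)) (X (i + 1)) = quad (p i) (s i) (t i) (X (i + 1)))
    (hleft : quad (p 0) (s 0) (t 0) (X 0) = 0)
    (hright : quad (p (N - 1)) (s (N - 1)) (t (N - 1)) (X N) = 0) :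
    |∑ i ∈ Finset.range N, ∫ x in Ioo (X i) (X (i + 1)), G x * bub (X i) (X (i + 1)) (s i) (t i) x|
      ≤ 8 * B * δ ^ 3 * Real.sqrt (∑ i ∈ Finset.range N,
          ∫ x in Ioo (X i) (X (i + 1)), quad (p i) (s i) (t i) x ^ 2) := by
  obtain ⟨N', rfl⟩ : ∃ N', N = N' + 1 := ⟨N - 1, by omega⟩
  set h : ℕ → ℝ := fun i => X (i + 1) - X i with hh
  set E : ℕ → ℝ := fun i => rms (X i) (X (i + 1)) (p i) (s i) (t i) with hEdef
  have hE : ∀ i, 0 ≤ E i := fun i => rms_nonneg _ _ _ _ _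
  have hpos : ∀ i < N' + 1, 0 < h i := fun i hi => sub_pos.2 (hX.lt i hi)
  have hle : ∀ i < N' + 1, h i ≤ 2 * δ ^ 2 := hX.step_le
  set R : ℝ := Real.sqrt (∑ i ∈ Finset.range (N' + 1),
          ∫ x in Ioo (X i) (X (i + 1)), quad (p i) (s i) (t i) x ^ 2) with hR
  have hR0 : 0 ≤ R := Real.sqrt_nonneg _
  have hRE : R = Real.sqrt (∑ i ∈ Finset.range (N' + 1), h i * E i ^ 2) := by
    rw [hR]
    congr 1
    exact Finset.sum_congr rfl fun i hi => (rms_sq (hX.lt i (Finset.mem_range.1 hi)) _ _ _).symm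
  -- Two powers of `h` give `4 δ⁴`, the third is the weight in Cauchy-Schwarz; one factor `δ` is
  -- given away.
  have hcube : ∑ i ∈ Finset.range (N' + 1), h i ^ 3 * E i ≤ 4 * δ ^ 3 * R := by
    calc ∑ i ∈ Finset.range (N' + 1), h i ^ 3 * E i
        ≤ ∑ i ∈ Finset.range (N' + 1), (2 * δ ^ 2) ^ 2 * (h i * E i) := by
          refine Finset.sum_le_sum fun i hi => ?_
          have hi := Finset.mem_range.1 hi
          have := hpos i hi
          rw [show h i ^ 3 * E i = h i ^ 2 * (h i * E i) by ring]
          have := hE i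
          have := hle i hi
          gcongr
      _ = (2 * δ ^ 2) ^ 2 * ∑ i ∈ Finset.range (N' + 1), h i * E i := by rw [Finset.mul_sum]
      _ ≤ (2 * δ ^ 2) ^ 2 * R := by
          rw [hRE]
          gcongr
          exact sum_weight_mul_le _ _ _ (fun i hi => (hpos i (Finset.mem_range.1 hi)).le)
            hX.sum_step.le
      _ = 4 * δ ^ 3 * R * δ := by ring
      _ ≤ 4 * δ ^ 3 * R := mul_le_of_le_one_right (by positivity) hδ1
  -- For a single cell only `h E² ≤ R²` is available, so `h² E ≤ h^(3/2) R`. This is where the order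
  -- `3/2` arises; `3` rounds up `√8`.
  have hjump : ∀ i < N' + 1, h i ^ 2 * E i ≤ 3 * δ ^ 3 * R := by
    intro i hi
    have h0 := (hpos i hi).le
    have h1 : h i * E i ^ 2 ≤ R ^ 2 := by
      rw [hRE, Real.sq_sqrt (Finset.sum_nonneg fun i hi =>
        mul_nonneg (hpos i (Finset.mem_range.1 hi)).le (sq_nonneg _))]
      exact Finset.single_le_sum (f := fun i => h i * E i ^ 2) (fun i hi =>
        mul_nonneg (hpos i (Finset.mem_range.1 hi)).le (sq_nonneg _)) (Finset.mem_range.2 hi)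
    refine abs_le_of_sq_le_sq' ?_ (by positivity) |>.2
    calc (h i ^ 2 * E i) ^ 2 = h i ^ 3 * (h i * E i ^ 2) := by ring
      _ ≤ (2 * δ ^ 2) ^ 3 * R ^ 2 := by
        have := hle i hi
        gcongr
      _ ≤ (3 * δ ^ 3 * R) ^ 2 := by nlinarith [sq_nonneg (δ ^ 3 * R)]
  set g : ℕ → ℝ := fun i => G ((X i + X (i + 1)) / 2) with hg
  have hmid : ∀ i < N' + 1, (X i + X (i + 1)) / 2 ∈ Ioo (0 : ℝ) 1 := fun i hi =>
    hX.Ioo_subset hi ⟨by linarith [hX.lt i hi], by linarith [hX.lt i hi]⟩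
  -- `F i` is the common value at the node `X i`. The default `0` past the last cell encodes the
  -- condition at the right end.
  set F : ℕ → ℝ := fun i => if i < N' + 1 then quad (p i) (s i) (t i) (X i) else 0 with hF
  have hF0 : F 0 = 0 := by simp [hF, hleft]
  have hFN : F (N' + 1) = 0 := by simp [hF]
  have hFi : ∀ i < N' + 1, F i = quad (p i) (s i) (t i) (X i) := fun i hi => if_pos hi
  have hFs : ∀ i < N' + 1, F (i + 1) = quad (p i) (s i) (t i) (X (i + 1)) := by
    intro i hi
    by_cases hi' : i + 1 < N' + 1
    · rw [hFi _ hi', hcont i hi']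
    · obtain rfl : i = N' := by omega
      rw [hFN]; exact hright.symm
  have hsum : ∑ i ∈ Finset.range (N' + 1), h i ^ 2 / 12 * g i * (F (i + 1) - F i)
      = - ∑ i ∈ Finset.range N', F (i + 1) * (h (i + 1) ^ 2 / 12 * g (i + 1) - h i ^ 2 / 12 * g i)
      := by
    rw [sum_mul_diff (fun i => h i ^ 2 / 12 * g i) F N', hF0, hFN]; ring
  -- The index `i` stands for the interior node `i + 1`, hence `n - 1` and `m - 1` for the
  -- transition points.
  have hterm : ∀ i ∈ Finset.range N',
      |F (i + 1) * (h (i + 1) ^ 2 / 12 * g (i + 1) - h i ^ 2 / 12 * g i)|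
      ≤ B / 4 * (h (i + 1) ^ 3 * E (i + 1)) + (if i = n - 1 then 3 / 2 * B * δ ^ 3 * R else 0)
        + (if i = m - 1 then 3 / 2 * B * δ ^ 3 * R else 0) := by
    intro i hi
    have hi : i < N' := Finset.mem_range.1 hi
    have hi1 : i + 1 < N' + 1 := by omega
    have hi0 : i < N' + 1 := by omega
    have hp1 := hpos _ hi1
    have hp0 := hpos _ hi0
    have hJ : 0 ≤ 3 / 2 * B * δ ^ 3 * R := by positivity
    have hE1 := hE (i + 1)
    have hT : 0 ≤ B / 4 * (h (i + 1) ^ 3 * E (i + 1)) := by positivity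
    have hFa : |F (i + 1)| ≤ 3 * E (i + 1) := by
      rw [hFi _ hi1]; exact abs_quad_left_le (hX.lt _ hi1) _ _ _
    have hFb : |F (i + 1)| ≤ 3 * E i := by
      rw [hFs _ hi0]; exact abs_quad_right_le (hX.lt _ hi0) _ _ _
    have hga := hG0 _ (hmid _ hi1)
    have hgb := hG0 _ (hmid _ hi0)
    -- At a transition point no cancellation is used: `k` is the coarser neighbour, whose length
    -- bounds both steps and whose root mean square bounds the nodal value.
    have hjmp : ∀ k < N' + 1, |F (i + 1)| ≤ 3 * E k → h (i + 1) ≤ h k → h i ≤ h k →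
        |F (i + 1) * (h (i + 1) ^ 2 / 12 * g (i + 1) - h i ^ 2 / 12 * g i)|
          ≤ 3 / 2 * B * δ ^ 3 * R := by
      intro k hk hFk hk1 hk0
      have hc : |h (i + 1) ^ 2 / 12 * g (i + 1) - h i ^ 2 / 12 * g i| ≤ h k ^ 2 / 6 * B := by
        calc _ ≤ |h (i + 1) ^ 2 / 12 * g (i + 1)| + |h i ^ 2 / 12 * g i| := abs_sub _ _
          _ = h (i + 1) ^ 2 / 12 * |g (i + 1)| + h i ^ 2 / 12 * |g i| := by
            rw [abs_mul, abs_mul, abs_of_nonneg (show 0 ≤ h (i + 1) ^ 2 / 12 by positivity),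
              abs_of_nonneg (show 0 ≤ h i ^ 2 / 12 by positivity)]
          _ ≤ h k ^ 2 / 12 * B + h k ^ 2 / 12 * B := by gcongr
          _ = h k ^ 2 / 6 * B := by ring
      rw [abs_mul]
      calc _ ≤ 3 * E k * (h k ^ 2 / 6 * B) :=
            mul_le_mul hFk hc (abs_nonneg _) (by have := hE k; positivity)
        _ = B / 2 * (h k ^ 2 * E k) := by ring
        _ ≤ B / 2 * (3 * δ ^ 3 * R) := mul_le_mul_of_nonneg_left (hjump k hk) (by positivity)
        _ = _ := by ring
    by_cases hn : i + 1 = n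
    · have := hjmp (i + 1) hi1 hFa le_rfl (hX.jump_left i hn)
      rw [if_pos (show i = n - 1 by omega)]
      split_ifs <;> linarith
    by_cases hm : i + 1 = m
    · have := hjmp i hi0 hFb (hX.jump_right i hm) le_rfl
      rw [if_pos (show i = m - 1 by omega)]
      split_ifs <;> linarith
    -- Between equal cells only the midpoint values of `G` differ, and the midpoints are one step
    -- apart.
    have hu : h i = h (i + 1) := (hX.uniform i hi1 hn hm).symm
    have hd : |g (i + 1) - g i| ≤ B * h (i + 1) := by
      have := hG _ (hmid _ hi1) _ (hmid _ hi0)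
      rwa [show (X (i + 1) + X (i + 1 + 1)) / 2 - (X i + X (i + 1)) / 2
        = (h (i + 1) + h i) / 2 by simp only [hh]; ring, hu, add_self_div_two,
        abs_of_pos hp1] at this
    have : |F (i + 1) * (h (i + 1) ^ 2 / 12 * g (i + 1) - h i ^ 2 / 12 * g i)|
        ≤ B / 4 * (h (i + 1) ^ 3 * E (i + 1)) := by
      rw [hu, ← mul_sub, abs_mul, abs_mul,
        abs_of_nonneg (show 0 ≤ h (i + 1) ^ 2 / 12 by positivity)]
      calc _ ≤ 3 * E (i + 1) * (h (i + 1) ^ 2 / 12 * (B * h (i + 1))) := by gcongr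
        _ = _ := by ring
    split_ifs <;> linarith
  have hite : ∀ k : ℕ, ∑ i ∈ Finset.range N', (if i = k then 3 / 2 * B * δ ^ 3 * R else 0)
      ≤ 3 / 2 * B * δ ^ 3 * R := by
    intro k
    rw [Finset.sum_ite_eq']
    split_ifs
    · exact le_rfl
    · positivity
  -- The constant is `1` from the equal cells plus `3/2` from each transition point.
  have hmain : |∑ i ∈ Finset.range (N' + 1), h i ^ 2 / 12 * g i * (F (i + 1) - F i)|
      ≤ 4 * B * δ ^ 3 * R := by
    rw [hsum, abs_neg]
    refine (Finset.abs_sum_le_sum_abs _ _).trans ((Finset.sum_le_sum hterm).trans ?_)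
    rw [Finset.sum_add_distrib, Finset.sum_add_distrib, ← Finset.mul_sum]
    have h1 : ∑ i ∈ Finset.range N', h (i + 1) ^ 3 * E (i + 1) ≤ 4 * δ ^ 3 * R := by
      rw [Finset.sum_range_succ'] at hcube
      have : 0 ≤ h 0 ^ 3 * E 0 := mul_nonneg (pow_nonneg (hpos 0 hN).le 3) (hE 0)
      linarith
    have h2 := hite (n - 1)
    have h3 := hite (m - 1)
    have h4 : B / 4 * ∑ i ∈ Finset.range N', h (i + 1) ^ 3 * E (i + 1)
      ≤ B / 4 * (4 * δ ^ 3 * R) := by gcongr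
    linarith
  have herr : |(∑ i ∈ Finset.range (N' + 1),
        ∫ x in Ioo (X i) (X (i + 1)), G x * bub (X i) (X (i + 1)) (s i) (t i) x)
      + ∑ i ∈ Finset.range (N' + 1), h i ^ 2 / 12 * g i * (F (i + 1) - F i)|
      ≤ B * (4 * δ ^ 3 * R) := by
    rw [← Finset.sum_add_distrib]
    refine (Finset.abs_sum_le_sum_abs _ _).trans ?_
    refine le_trans ?_ (mul_le_mul_of_nonneg_left hcube hB)
    rw [Finset.mul_sum]
    refine Finset.sum_le_sum fun i hi => ?_
    have hi := Finset.mem_range.1 hi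
    rw [hFs i hi, hFi i hi, ← mul_assoc]
    exact abs_integral_mul_bub_sub_le (hX.lt i hi) hB (fun x hx y hy =>
      hG x (hX.Ioo_subset hi hx) y (hX.Ioo_subset hi hy)) _ _ _
  rw [abs_le] at hmain herr ⊢
  constructor <;> linarith [hmain.1, hmain.2, herr.1, herr.2]

/-! ### Smooth functions on the open square -/

theorem isOpen_Om : IsOpen Om := isOpen_Ioo.prod isOpen_Ioo

theorem Om_subset_OmBar : Om ⊆ OmBar := prod_mono Ioo_subset_Icc_self Ioo_subset_Icc_self

theorem measurableSet_cell (X : ℕ → ℝ) (i j : ℕ) : MeasurableSet (cell X i j) :=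
  measurableSet_Ioo.prod measurableSet_Ioo

theorem hasDerivAt_dx {g : ℝ × ℝ → ℝ} {n : ℕ} (hg : ContDiffOn ℝ n g Om) (hn : n ≠ 0)
    {p : ℝ × ℝ} (hp : p ∈ Om) :
    HasDerivAt (fun t => g (t, p.2)) (dx g p) p.1 ∧ dx g p = fderiv ℝ g p (1, 0) := by
  have hd : DifferentiableAt ℝ g p :=
    (hg.contDiffAt (isOpen_Om.mem_nhds hp)).differentiableAt (by exact_mod_cast hn)
  have h1 : HasDerivAt (fun t : ℝ => (t, p.2)) ((1 : ℝ), (0 : ℝ)) p.1 :=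
    (hasDerivAt_id _).prodMk (hasDerivAt_const _ _)
  have h2 : HasDerivAt (fun t => g (t, p.2)) (fderiv ℝ g p (1, 0)) p.1 :=
    HasFDerivAt.comp_hasDerivAt (f := fun t : ℝ => (t, p.2)) p.1 (l := g) hd.hasFDerivAt h1
  have h3 : dx g p = fderiv ℝ g p (1, 0) := h2.deriv
  exact ⟨h3 ▸ h2, h3⟩

theorem contDiffOn_dx {g : ℝ × ℝ → ℝ} {n : ℕ} (hg : ContDiffOn ℝ (n + 1 : ℕ) g Om) :
    ContDiffOn ℝ n (dx g) Om := by
  have h : ContDiffOn ℝ n (fun p => fderiv ℝ g p (1, 0)) Om :=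
    (hg.fderiv_of_isOpen isOpen_Om (by norm_cast)).clm_apply contDiffOn_const
  exact h.congr fun p hp => (hasDerivAt_dx hg (by omega) hp).2

/-- `g` is `k` times continuously differentiable on the open square and its pure `x`-derivatives
are bounded by `M`. -/
structure XReg (k : ℕ) (g : ℝ × ℝ → ℝ) (M : ℝ) : Prop where
  contDiffOn : ContDiffOn ℝ k g Om
  bound : ∀ i ≤ k, ∀ p ∈ Om, |dx^[i] g p| ≤ M

namespace XReg

variable {k : ℕ} {g : ℝ × ℝ → ℝ} {M : ℝ}

theorem deriv (h : XReg (k + 1) g M) : XReg k (dx g) M :=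
  ⟨contDiffOn_dx h.contDiffOn, fun i hi p hp => h.bound (i + 1) (by omega) p hp⟩

theorem mono {l : ℕ} (h : XReg k g M) (hl : l ≤ k) : XReg l g M :=
  ⟨h.contDiffOn.of_le (by exact_mod_cast hl), fun i hi => h.bound i (hi.trans hl)⟩

theorem abs_le (h : XReg k g M) {p : ℝ × ℝ} (hp : p ∈ Om) : |g p| ≤ M := h.bound 0 (by omega) p hp

theorem nonneg (h : XReg k g M) : 0 ≤ M :=
  (abs_nonneg _).trans (h.abs_le (p := (1 / 2, 1 / 2)) (by norm_num [Om]))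

theorem hasDerivAt (h : XReg (k + 1) g M) {x y : ℝ} (hp : (x, y) ∈ Om) :
    HasDerivAt (fun t => g (t, y)) (dx g (x, y)) x :=
  (hasDerivAt_dx h.contDiffOn (by omega) hp).1

theorem lipschitz (h : XReg (k + 1) g M) {x x' y : ℝ} (hp : (x, y) ∈ Om) (hp' : (x', y) ∈ Om) :
    |g (x, y) - g (x', y)| ≤ M * |x - x'| :=
  (convex_Ioo (0 : ℝ) 1).norm_image_sub_le_of_norm_hasDerivWithin_le (f := fun t => g (t, y))
    (fun t ht => (h.hasDerivAt (x := t) (y := y) ⟨ht, hp.2⟩).hasDerivWithinAt)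
    (fun t ht => h.bound 1 (by omega) (t, y) ⟨ht, hp.2⟩) hp'.1 hp.1

end XReg

theorem iterate_dx_swap (g : ℝ × ℝ → ℝ) (i : ℕ) :
    dx^[i] (g ∘ Prod.swap) = (dy^[i] g) ∘ Prod.swap := by
  induction i with
  | zero => rfl
  | succ i ih => rw [Function.iterate_succ_apply', ih, Function.iterate_succ_apply']; rfl

theorem CkBound.xReg {k : ℕ} {g : ℝ × ℝ → ℝ} {M : ℝ} (h : CkBound k g M) : XReg k g M :=
  ⟨h.1.mono Om_subset_OmBar, fun i hi p hp => h.2 i 0 hi p hp⟩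

theorem CkBound.xReg_swap {k : ℕ} {g : ℝ × ℝ → ℝ} {M : ℝ} (h : CkBound k g M) :
    XReg k (g ∘ Prod.swap) M := by
  refine ⟨(h.1.mono Om_subset_OmBar).comp (contDiff_snd.prodMk contDiff_fst).contDiffOn
    fun p hp => ⟨hp.2, hp.1⟩, fun i hi p hp => ?_⟩
  rw [iterate_dx_swap]
  exact h.2 0 i (by omega) p.swap ⟨hp.2, hp.1⟩

/-! ### Integration over the mesh cells -/

theorem integrableOn_cell_of_continuous (X : ℕ → ℝ) (i j : ℕ) {g : ℝ × ℝ → ℝ}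
    (hg : Continuous g) : IntegrableOn g (cell X i j) :=
  (hg.continuousOn.integrableOn_compact (isCompact_Icc.prod isCompact_Icc)).mono_set
      (prod_mono Ioo_subset_Icc_self Ioo_subset_Icc_self)

theorem integrableOn_cell {X : ℕ → ℝ} {i j : ℕ} (hc : cell X i j ⊆ Om) {F g : ℝ × ℝ → ℝ} {B : ℝ}
    (hF : ContinuousOn F Om) (hFB : ∀ p ∈ Om, |F p| ≤ B) (hg : Continuous g) :
    IntegrableOn (fun p => F p * g p) (cell X i j) := by
  exact (integrableOn_cell_of_continuous X i j hg).bdd_mul (c := B) ((hF.mono hc).aestronglyMeasurable (measurableSet_cell X i j))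
    ((ae_restrict_iff' (measurableSet_cell X i j)).2 (ae_of_all _ fun p hp => hFB p (hc hp)))

theorem setIntegral_cell {X : ℕ → ℝ} {i j : ℕ} {g : ℝ × ℝ → ℝ} (hg : IntegrableOn g (cell X i j)) :
    ∫ p in cell X i j, g p
      = ∫ y in Ioo (X j) (X (j + 1)), ∫ x in Ioo (X i) (X (i + 1)), g (x, y) := by
  rw [IntegrableOn, cell, Measure.volume_eq_prod, ← Measure.prod_restrict] at hg
  rw [cell, Measure.volume_eq_prod, ← Measure.prod_restrict]
  exact integral_prod_symm g hg

theorem integrableOn_inner {X : ℕ → ℝ} {i j : ℕ} {g : ℝ × ℝ → ℝ}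
    (hg : IntegrableOn g (cell X i j)) :
    IntegrableOn (fun y => ∫ x in Ioo (X i) (X (i + 1)), g (x, y)) (Ioo (X j) (X (j + 1))) := by
  rw [IntegrableOn, cell, Measure.volume_eq_prod, ← Measure.prod_restrict] at hg
  exact hg.integral_prod_right

theorem setIntegral_cell_swap (X : ℕ → ℝ) (i j : ℕ) (g : ℝ × ℝ → ℝ) :
    ∫ p in cell X i j, g p = ∫ p in cell X j i, g p.swap :=
  (setIntegral_prod_swap _ _ g).symm

/-! ### The two-dimensional estimate in the `x`-direction -/

/-- The mean value over an edge gives a lower bound of the `L²` norm of the derivative. -/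
theorem mul_integral_quad_sq_le {X : ℕ → ℝ} {i j : ℕ} (hj : X j < X (j + 1)) (p s t r : ℝ) :
    (X (j + 1) - X j) * (∫ x in Ioo (X i) (X (i + 1)),
        quad (p + r * ((X j + X (j + 1)) / 2)) s t x ^ 2)
      ≤ ∫ q in cell X i j, (quad p s t q.1 + r * q.2) ^ 2 := by
  set m := (X j + X (j + 1)) / 2 with hm
  set P := fun x => quad (p + r * m) s t x with hP
  have hPc : Continuous P := continuous_quad _ _ _
  have h1 : ∫ q in cell X i j, P q.1 ^ 2 * 1
      = (∫ x in Ioo (X i) (X (i + 1)), P x ^ 2) * ∫ y in Ioo (X j) (X (j + 1)), (1 : ℝ) :=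
    setIntegral_prod_mul (fun x => P x ^ 2) (fun _ => (1 : ℝ)) _ _
  -- Expanding about the midpoint `m` of the edge, the cross term has mean zero in `y` and the
  -- square of `r (y - m)` may be dropped.
  have h2 : ∫ q in cell X i j, P q.1 * (2 * r * (q.2 - m))
      = (∫ x in Ioo (X i) (X (i + 1)), P x) * ∫ y in Ioo (X j) (X (j + 1)), 2 * r * (y - m) :=
    setIntegral_prod_mul P (fun y => 2 * r * (y - m)) _ _
  have h3 : ∫ y in Ioo (X j) (X (j + 1)), 2 * r * (y - m) = 0 := by
    have := integral_quartic hj.le (-(2 * r * m)) (2 * r) 0 0 0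
    rw [show (fun y => 2 * r * (y - m)) = fun y => -(2 * r * m) + 2 * r * y + 0 * y ^ 2 + 0 * y ^ 3
      + 0 * y ^ 4 by funext y; ring, this, hm]
    ring
  have h4 : ∫ y in Ioo (X j) (X (j + 1)), (1 : ℝ) = X (j + 1) - X j := by
    simp [measureReal_def, hj.le]
  rw [h3, mul_zero] at h2
  rw [h4] at h1
  rw [mul_comm, ← h1, ← add_zero (∫ q in cell X i j, P q.1 ^ 2 * 1), ← h2]
  rw [← integral_add (integrableOn_cell_of_continuous X i j (by fun_prop))
    (integrableOn_cell_of_continuous X i j (by fun_prop))]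
  refine setIntegral_mono (integrableOn_cell_of_continuous X i j (by fun_prop))
    (integrableOn_cell_of_continuous X i j (by unfold quad; fun_prop)) fun q => ?_
  have : quad p s t q.1 + r * q.2 = P q.1 + r * (q.2 - m) := by
    simp only [hP, quad]; ring
  simp only [this]
  nlinarith [sq_nonneg (r * (q.2 - m))]

/-- For each fixed `y` in a strip the one-dimensional estimate applies with the edge means in place
of the pointwise derivative, since `bub` does not see the constant term. Integrating in `y` yields
the strip heights as weights; they sum to `1`, so Cauchy-Schwarz over the strips costs nothing. -/
theorem abs_meshIntegral_mul_bub_le {X : ℕ → ℝ} {N n m : ℕ} {δ B : ℝ}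
    (hX : IsTwoJumpMesh X N n m δ) (hN : 0 < N) (hδ : 0 ≤ δ) (hδ1 : δ ≤ 1)
    (hB : 0 ≤ B) {F : ℝ × ℝ → ℝ} (hFc : ContinuousOn F Om) (hF0 : ∀ p ∈ Om, |F p| ≤ B)
    (hF : ∀ x x' y, (x, y) ∈ Om → (x', y) ∈ Om → |F (x, y) - F (x', y)| ≤ B * |x - x'|)
    (p s t r : ℕ → ℕ → ℝ)
    (hcont : ∀ i, i + 1 < N → ∀ j < N,
      quad (p (i + 1) j + r (i + 1) j * ((X j + X (j + 1)) / 2)) (s (i + 1) j) (t (i + 1) j)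
        (X (i + 1)) = quad (p i j + r i j * ((X j + X (j + 1)) / 2)) (s i j) (t i j) (X (i + 1)))
    (hleft : ∀ j < N, quad (p 0 j + r 0 j * ((X j + X (j + 1)) / 2)) (s 0 j) (t 0 j) (X 0) = 0)
    (hright : ∀ j < N, quad (p (N - 1) j + r (N - 1) j * ((X j + X (j + 1)) / 2)) (s (N - 1) j)
      (t (N - 1) j) (X N) = 0) :
    |meshIntegral X N fun i j q => F q * bub (X i) (X (i + 1)) (s i j) (t i j) q.1|
      ≤ 8 * B * δ ^ 3 * Real.sqrt (meshIntegral X N fun i j q =>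
          (quad (p i j) (s i j) (t i j) q.1 + r i j * q.2) ^ 2) := by
  set A : ℕ → ℝ := fun j => ∑ i ∈ Finset.range N, ∫ x in Ioo (X i) (X (i + 1)),
    quad (p i j + r i j * ((X j + X (j + 1)) / 2)) (s i j) (t i j) x ^ 2 with hA
  have hA0 : ∀ j, 0 ≤ A j := fun j =>
    Finset.sum_nonneg fun i _ => integral_nonneg fun x => sq_nonneg _
  have hstrip : ∀ j ∈ Finset.range N, |∑ i ∈ Finset.range N, ∫ q in cell X i j,
      F q * bub (X i) (X (i + 1)) (s i j) (t i j) q.1|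
      ≤ 8 * B * δ ^ 3 * ((X (j + 1) - X j) * Real.sqrt (A j)) := by
    intro j hj
    have hj := Finset.mem_range.1 hj
    have hint : ∀ i ∈ Finset.range N, IntegrableOn
        (fun q => F q * bub (X i) (X (i + 1)) (s i j) (t i j) q.1) (cell X i j) := fun i hi =>
      integrableOn_cell (hX.cell_subset (Finset.mem_range.1 hi) hj) hFc hF0
        ((continuous_bub _ _ _ _).comp continuous_fst)
    rw [Finset.sum_congr rfl fun i hi => setIntegral_cell (hint i hi),
      ← integral_finsetSum _ fun i hi => integrableOn_inner (hint i hi)]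
    have := norm_setIntegral_le_of_norm_le_const (μ := volume) (s := Ioo (X j) (X (j + 1)))
      (C := 8 * B * δ ^ 3 * Real.sqrt (A j))
      (f := fun y => ∑ i ∈ Finset.range N, ∫ x in Ioo (X i) (X (i + 1)),
        F (x, y) * bub (X i) (X (i + 1)) (s i j) (t i j) x) (by simp) (fun y hy =>
        abs_sum_integral_mul_bub_le hX hN hδ hδ1 hB (G := fun x => F (x, y))
          (fun x hx => hF0 _ ⟨hx, hX.Ioo_subset hj hy⟩)
          (fun x hx x' hx' => hF x x' y ⟨hx, hX.Ioo_subset hj hy⟩ ⟨hx', hX.Ioo_subset hj hy⟩)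
          (fun i => p i j + r i j * ((X j + X (j + 1)) / 2)) (fun i => s i j) (fun i => t i j)
          (fun i hi => hcont i hi j hj) (hleft j hj) (hright j hj))
    rw [Real.norm_eq_abs, measureReal_def, Real.volume_Ioo,
      ENNReal.toReal_ofReal (sub_pos.2 (hX.lt j hj)).le] at this
    exact this.trans_eq (by ring)
  rw [meshIntegral, Finset.sum_comm]
  refine (Finset.abs_sum_le_sum_abs _ _).trans ((Finset.sum_le_sum hstrip).trans ?_)
  rw [← Finset.mul_sum]
  gcongr
  refine (sum_weight_mul_le _ _ _ (fun j hj =>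
    (sub_pos.2 (hX.lt j (Finset.mem_range.1 hj))).le) hX.sum_step.le).trans (Real.sqrt_le_sqrt ?_)
  rw [meshIntegral, Finset.sum_comm]
  refine Finset.sum_le_sum fun j hj => ?_
  rw [Real.sq_sqrt (hA0 j), hA, Finset.mul_sum]
  exact Finset.sum_le_sum fun i _ =>
    mul_integral_quad_sq_le (hX.lt j (Finset.mem_range.1 hj)) _ _ _ _

/-- Integration by parts in `x` on a cell: there is no boundary term, as `bub` vanishes. -/
theorem integral_mul_bubDeriv {X : ℕ → ℝ} {i j : ℕ} (hi : X i < X (i + 1)) (hc : cell X i j ⊆ Om)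
    {g g' : ℝ × ℝ → ℝ} {M M' : ℝ} (hg : ContinuousOn g Om) (hgM : ∀ p ∈ Om, |g p| ≤ M)
    (hg' : ContinuousOn g' Om) (hgM' : ∀ p ∈ Om, |g' p| ≤ M')
    (hd : ∀ x y, (x, y) ∈ Om → HasDerivAt (fun t => g (t, y)) (g' (x, y)) x) (s t : ℝ) :
    ∫ q in cell X i j, g q * bubDeriv (X i) (X (i + 1)) s t q.1
      = ∫ q in cell X i j, -g' q * bub (X i) (X (i + 1)) s t q.1 := by
  set β := bub (X i) (X (i + 1)) s t with hβ
  set β' := bubDeriv (X i) (X (i + 1)) s t with hβ'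
  have hβc : Continuous β := continuous_bub _ _ _ _
  have hβ'c : Continuous β' := continuous_bubDeriv _ _ _ _
  rw [setIntegral_cell (g := fun q => g q * β' q.1)
      (integrableOn_cell hc hg hgM (hβ'c.comp continuous_fst)),
    setIntegral_cell (g := fun q => -g' q * β q.1)
      (integrableOn_cell hc hg'.neg (fun p hp => by simpa using hgM' p hp)
        (hβc.comp continuous_fst))]
  refine setIntegral_congr_fun measurableSet_Ioo fun y hy => ?_
  have hline : ∀ x ∈ Ioo (X i) (X (i + 1)), (x, y) ∈ Om := fun x hx => hc ⟨hx, hy⟩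
  have hcl : ContinuousOn (fun x : ℝ => (x, y)) (Ioo (X i) (X (i + 1))) := by fun_prop
  have hint : ∀ {u : ℝ × ℝ → ℝ} {K : ℝ} {b : ℝ → ℝ}, ContinuousOn u Om → (∀ p ∈ Om, |u p| ≤ K) →
      Continuous b → IntegrableOn (fun x => u (x, y) * b x) (Ioo (X i) (X (i + 1))) := by
    intro u K b hu huK hb
    refine (hb.integrableOn_Icc.mono_set Ioo_subset_Icc_self).bdd_mul (c := K)
      ((hu.comp hcl hline).aestronglyMeasurable measurableSet_Ioo)
      ((ae_restrict_iff' measurableSet_Ioo).2 (ae_of_all _ fun x hx => huK _ (hline x hx)))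
  -- The coefficient is controlled on the open square only, so boundary values are taken as limits:
  -- a bounded factor times one tending to `0`.
  have hlim : ∀ {l : Filter ℝ} {x₀ : ℝ}, l ≤ nhds x₀ → β x₀ = 0 →
      (∀ᶠ x in l, x ∈ Ioo (X i) (X (i + 1))) →
      Filter.Tendsto (fun x => g (x, y) * β x) l (nhds 0) := by
    intro l x₀ hl h0 hev
    have h1 : Filter.Tendsto (fun x => M * |β x|) l (nhds 0) := by
      have h2 : Filter.Tendsto (fun x => M * |β x|) (nhds x₀) (nhds (M * |β x₀|)) :=
        (continuous_const.mul hβc.abs).tendsto x₀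
      rw [h0, abs_zero, mul_zero] at h2
      exact h2.mono_left hl
    refine squeeze_zero_norm' (hev.mono fun x hx => ?_) h1
    rw [norm_mul]
    exact mul_le_mul_of_nonneg_right (hgM _ (hline x hx)) (abs_nonneg _)
  have hparts := intervalIntegral.integral_eq_sub_of_hasDerivAt_of_tendsto hi
    (f := fun x => g (x, y) * β x) (f' := fun x => g' (x, y) * β x + g (x, y) * β' x)
    (fa := 0) (fb := 0)
    (fun x hx => (hd x y (hline x hx)).mul (hasDerivAt_bub _ _ _ _ x))
    ((intervalIntegrable_iff_integrableOn_Ioo_of_le hi.le).2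
      ((hint hg' hgM' hβc).add (hint hg hgM hβ'c)))
    (hlim nhdsWithin_le_nhds (by simp [hβ, bub]) (Ioo_mem_nhdsGT hi))
    (hlim nhdsWithin_le_nhds (by simp [hβ, bub]) (Ioo_mem_nhdsLT hi))
  rw [← integral_Ioo_eq_interval hi.le, integral_add (hint hg' hgM' hβc) (hint hg hgM hβ'c)]
    at hparts
  simp only [neg_mul, integral_neg]
  linarith

/-! ### The Shishkin mesh -/

theorem node_left {ε : ℝ} {k i : ℕ} (hi : i ≤ k) :
    node ε (4 * k) i = i * (lam ε (4 * k) / k) := by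
  rw [node, if_pos (by omega)]
  push_cast
  rw [mul_div_cancel_left₀ (k : ℝ) (by norm_num : (4 : ℝ) ≠ 0)]

/-- The neighbouring branches agree at `k` and `3k`. With closed ranges, every step is a difference
within one branch. -/
theorem node_mid {ε : ℝ} {k i : ℕ} (hk : 0 < k) (h1 : k ≤ i) (h2 : i ≤ 3 * k) :
    node ε (4 * k) i
      = lam ε (4 * k) + ((i : ℝ) - k) * ((1 - 2 * lam ε (4 * k)) / (2 * k)) := by
  have hk' : (k : ℝ) ≠ 0 := by positivity
  rcases h1.eq_or_lt with rfl | h1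
  · rw [node_left le_rfl]; field_simp; ring
  · rw [node, if_neg (by omega), if_pos (by omega)]
    push_cast
    rw [show (4 * k / 4 : ℝ) = k by ring, show (4 * k / 2 : ℝ) = 2 * k by ring]

theorem node_right {ε : ℝ} {k i : ℕ} (hk : 0 < k) (h : 3 * k ≤ i) :
    node ε (4 * k) i = 1 - lam ε (4 * k) + ((i : ℝ) - 3 * k) * (lam ε (4 * k) / k) := by
  have hk' : (k : ℝ) ≠ 0 := by positivity
  rcases h.eq_or_lt with rfl | h
  · rw [node_mid hk (by omega) le_rfl]; push_cast; field_simp; ring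
  · rw [node, if_neg (by omega), if_neg (by omega)]
    push_cast
    rw [show (4 * k / 4 : ℝ) = k by ring, show (3 * (4 * k) / 4 : ℝ) = 3 * k by ring]

theorem isTwoJumpMesh_node {ε : ℝ} (hε : 0 < ε) {k : ℕ} (hk : 0 < k) {δ : ℝ}
    (hδ : δ ^ 2 = 1 / (4 * k)) : IsTwoJumpMesh (node ε (4 * k)) (4 * k) k (3 * k) δ := by
  have hk' : (0 : ℝ) < k := by positivity
  set Λ := lam ε (4 * k) with hΛ
  have hΛ1 : Λ ≤ 1 / 4 := min_le_right _ _
  have hΛ0 : 0 < Λ := by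
    refine lt_min (mul_pos hε (Real.log_pos ?_)) (by norm_num)
    have : (1 : ℝ) ≤ k := by exact_mod_cast hk
    push_cast; linarith
  have s1 : ∀ i, i < k → node ε (4 * k) (i + 1) - node ε (4 * k) i = Λ / k := fun i hi => by
    rw [node_left hi, node_left hi.le]; push_cast; ring
  have s2 : ∀ i, k ≤ i → i < 3 * k →
      node ε (4 * k) (i + 1) - node ε (4 * k) i = (1 - 2 * Λ) / (2 * k) := fun i h1 h2 => by
    rw [node_mid hk (by omega) h2, node_mid hk h1 h2.le]; push_cast; ring
  have s3 : ∀ i, 3 * k ≤ i → node ε (4 * k) (i + 1) - node ε (4 * k) i = Λ / k := fun i hi => by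
    rw [node_right hk (by omega), node_right hk hi]; push_cast; ring
  have hpos1 : 0 < Λ / k := by positivity
  have hpos2 : 0 < (1 - 2 * Λ) / (2 * k) := div_pos (by linarith) (by positivity)
  -- The inner cells are the coarser ones because `Λ ≤ 1/4`.
  have hle : Λ / k ≤ (1 - 2 * Λ) / (2 * k) := by
    rw [div_le_div_iff₀ hk' (by positivity)]; nlinarith
  have hstep : (1 - 2 * Λ) / (2 * k) ≤ 2 * δ ^ 2 := by
    rw [hδ, mul_one_div, div_le_div_iff₀ (by positivity) (by positivity)]; nlinarith
  have hcases : ∀ i, i < k ∨ (k ≤ i ∧ i < 3 * k) ∨ 3 * k ≤ i := fun i => by omega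
  refine ⟨?_, ?_, fun i _ => ?_, fun i _ => ?_, fun i _ h1 h2 => ?_, fun i h => ?_, fun i h => ?_⟩
  · rw [node_left (Nat.zero_le _)]; simp
  · rw [node_right hk (by omega)]; push_cast; field_simp; ring
  · rw [← sub_pos]
    rcases hcases i with h | h | h
    · rwa [s1 i h]
    · rwa [s2 i h.1 h.2]
    · rwa [s3 i h]
  · rcases hcases i with h | h | h
    · rw [s1 i h]; linarith
    · rwa [s2 i h.1 h.2]
    · rw [s3 i h]; linarith
  · rcases hcases i with h | h | h
    · rw [s1 i h, s1 (i + 1) (by omega)]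
    · rw [s2 i h.1 h.2, s2 (i + 1) (by omega) (by omega)]
    · rw [s3 i h, s3 (i + 1) (by omega)]
  · rw [s1 i (by omega), s2 (i + 1) (by omega) (by omega)]; exact hle
  · rw [s2 i (by omega) (by omega), s3 (i + 1) (by omega)]; exact hle

/-! ### The Morley functions -/

theorem meshIntegral_congr {X : ℕ → ℝ} {N : ℕ} {g h : Broken}
    (H : ∀ i < N, ∀ j < N, ∀ q ∈ cell X i j, g i j q = h i j q) :
    meshIntegral X N g = meshIntegral X N h :=
  Finset.sum_congr rfl fun i hi => Finset.sum_congr rfl fun j hj =>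
    setIntegral_congr_fun (measurableSet_cell X i j)
      (H i (Finset.mem_range.1 hi) j (Finset.mem_range.1 hj))

theorem meshIntegral_add {X : ℕ → ℝ} {N : ℕ} {g h : Broken}
    (hg : ∀ i < N, ∀ j < N, IntegrableOn (g i j) (cell X i j))
    (hh : ∀ i < N, ∀ j < N, IntegrableOn (h i j) (cell X i j)) :
    meshIntegral X N (fun i j q => g i j q + h i j q)
      = meshIntegral X N g + meshIntegral X N h := by
  simp only [meshIntegral, ← Finset.sum_add_distrib]
  exact Finset.sum_congr rfl fun i hi => Finset.sum_congr rfl fun j hj =>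
    integral_add (hg i (Finset.mem_range.1 hi) j (Finset.mem_range.1 hj))
      (hh i (Finset.mem_range.1 hi) j (Finset.mem_range.1 hj))

theorem meshIntegral_swap (X : ℕ → ℝ) (N : ℕ) (g : Broken) :
    meshIntegral X N g = meshIntegral X N fun i j q => g j i q.swap := by
  simp only [meshIntegral]
  rw [Finset.sum_comm]
  exact Finset.sum_congr rfl fun i _ => Finset.sum_congr rfl fun j _ =>
    setIntegral_cell_swap X j i _

theorem meshIntegral_nonneg {X : ℕ → ℝ} {N : ℕ} {g : Broken} (hg : ∀ i j q, 0 ≤ g i j q) :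
    0 ≤ meshIntegral X N g :=
  Finset.sum_nonneg fun _ _ => Finset.sum_nonneg fun _ _ => integral_nonneg fun _ => hg _ _ _

/-- The Morley polynomial with coefficients `a`. -/
def morleyPoly (a : Fin 8 → ℝ) (q : ℝ × ℝ) : ℝ :=
  a 0 + a 1 * q.1 + a 2 * q.2 + a 3 * q.1 ^ 2 + a 4 * (q.1 * q.2) + a 5 * q.2 ^ 2 + a 6 * q.1 ^ 3
    + a 7 * q.2 ^ 3

theorem dx_morleyPoly (a : Fin 8 → ℝ) (q : ℝ × ℝ) :
    dx (morleyPoly a) q = quad (a 1) (a 3) (a 6) q.1 + a 4 * q.2 := by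
  refine HasDerivAt.deriv ?_
  have h2 : HasDerivAt (fun x : ℝ => x ^ 2) (2 * q.1) q.1 := by simpa using hasDerivAt_pow 2 q.1
  have h3 : HasDerivAt (fun x : ℝ => x ^ 3) (3 * q.1 ^ 2) q.1 := by
    simpa using hasDerivAt_pow 3 q.1
  have := ((((hasDerivAt_id q.1).const_mul (a 1 + a 4 * q.2)).add (h2.const_mul (a 3))).add
    (h3.const_mul (a 6))).add_const (a 0 + a 2 * q.2 + a 5 * q.2 ^ 2 + a 7 * q.2 ^ 3)
  convert this using 1
  · funext x; simp [morleyPoly]; ring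
  · unfold quad; ring

theorem dy_morleyPoly (a : Fin 8 → ℝ) (q : ℝ × ℝ) :
    dy (morleyPoly a) q = quad (a 2) (a 5) (a 7) q.2 + a 4 * q.1 := by
  have h := dx_morleyPoly ![a 0, a 2, a 1, a 5, a 4, a 3, a 7, a 6] q.swap
  have h' : dy (morleyPoly a) q
      = dx (morleyPoly ![a 0, a 2, a 1, a 5, a 4, a 3, a 7, a 6]) q.swap := by
    simp only [dy, dx]
    congr 1
    funext x
    simp [morleyPoly]
    ring
  rw [h', h]
  simp

/-- The only mixed monomial of `P(K)` is `xy`, which is reproduced, so the error splits into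
univariate linear interpolation errors. -/
theorem morleyPoly_sub_bilin (a : Fin 8 → ℝ) {x x' y y' : ℝ} (hx : x < x') (hy : y < y')
    (q : ℝ × ℝ) : morleyPoly a q - bilin x x' y y' (morleyPoly a) q
      = bub x x' (a 3) (a 6) q.1 + bub y y' (a 5) (a 7) q.2 := by
  have h1 : x' - x ≠ 0 := (sub_pos.2 hx).ne'
  have h2 : y' - y ≠ 0 := (sub_pos.2 hy).ne'
  rw [bilin, sub_eq_iff_eq_add, ← sub_eq_iff_eq_add', eq_div_iff (mul_ne_zero h1 h2)]
  unfold morleyPoly bub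
  ring

theorem integral_quad_add_mul {c d : ℝ} (hcd : c ≤ d) (p s t r x : ℝ) :
    ∫ y in c..d, (quad p s t x + r * y) = (d - c) * quad (p + r * ((c + d) / 2)) s t x := by
  rw [← integral_Ioo_eq_interval hcd]
  have := integral_quartic hcd (quad p s t x) r 0 0 0
  simp only [zero_mul, add_zero, zero_div] at this
  rw [this]
  unfold quad; ring

/-- On a vertical edge `∂v/∂x` is affine in `y`, so its mean is its value at the midpoint. -/
theorem vertFlux_morleyPoly {X : ℕ → ℝ} {j : ℕ} (hj : X j ≤ X (j + 1)) (a : Fin 8 → ℝ) (x : ℝ) :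
    vertFlux X (morleyPoly a) x j = (X (j + 1) - X j)
      * quad (a 1 + a 4 * ((X j + X (j + 1)) / 2)) (a 3) (a 6) x := by
  simp only [vertFlux, dx_morleyPoly]
  exact integral_quad_add_mul hj _ _ _ _ _

theorem horFlux_morleyPoly {X : ℕ → ℝ} {i : ℕ} (hi : X i ≤ X (i + 1)) (a : Fin 8 → ℝ) (y : ℝ) :
    horFlux X (morleyPoly a) i y = (X (i + 1) - X i)
      * quad (a 2 + a 4 * ((X i + X (i + 1)) / 2)) (a 5) (a 7) y := by
  simp only [horFlux, dy_morleyPoly]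
  exact integral_quad_add_mul hi _ _ _ _ _

/-- Bounded functions on the open square that are Lipschitz continuous in `x`. -/
structure XLip (F : ℝ × ℝ → ℝ) (B : ℝ) : Prop where
  continuousOn : ContinuousOn F Om
  bound : ∀ p ∈ Om, |F p| ≤ B
  lipschitz : ∀ x x' y, (x, y) ∈ Om → (x', y) ∈ Om → |F (x, y) - F (x', y)| ≤ B * |x - x'|

theorem XLip.nonneg {F : ℝ × ℝ → ℝ} {B : ℝ} (h : XLip F B) : 0 ≤ B :=
  (abs_nonneg _).trans (h.bound (1 / 2, 1 / 2) (by norm_num [Om]))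

theorem XReg.xLip {k : ℕ} {g : ℝ × ℝ → ℝ} {M : ℝ} (h : XReg (k + 1) g M) : XLip g M :=
  ⟨h.contDiffOn.continuousOn, fun _ hp => h.abs_le hp, fun _ _ _ hp hp' => h.lipschitz hp hp'⟩

theorem XLip.mul {F G : ℝ × ℝ → ℝ} {M : ℝ} (hF : XLip F M) (hG : XLip G M) :
    XLip (fun p => F p * G p) (2 * M ^ 2) := by
  have hM := hF.nonneg
  refine ⟨hF.continuousOn.mul hG.continuousOn, fun p hp => ?_, fun x x' y hp hp' => ?_⟩
  · rw [abs_mul]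
    have := mul_le_mul (hF.bound p hp) (hG.bound p hp) (abs_nonneg _) hM
    nlinarith
  · have h1 := hF.lipschitz x x' y hp hp'
    have h2 := hG.lipschitz x x' y hp hp'
    have h3 := hF.bound _ hp
    have h4 := hG.bound _ hp'
    calc |F (x, y) * G (x, y) - F (x', y) * G (x', y)|
        = |F (x, y) * (G (x, y) - G (x', y)) + (F (x, y) - F (x', y)) * G (x', y)| := by
          congr 1; ring
      _ ≤ |F (x, y)| * |G (x, y) - G (x', y)| + |F (x, y) - F (x', y)| * |G (x', y)| := by
          rw [← abs_mul, ← abs_mul]; exact abs_add_le _ _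
      _ ≤ M * (M * |x - x'|) + M * |x - x'| * M := by gcongr
      _ = 2 * M ^ 2 * |x - x'| := by ring

theorem XLip.add {F G : ℝ × ℝ → ℝ} {B B' : ℝ} (hF : XLip F B) (hG : XLip G B') :
    XLip (fun p => F p + G p) (B + B') := by
  refine ⟨hF.continuousOn.add hG.continuousOn, fun p hp => ?_, fun x x' y hp hp' => ?_⟩
  · exact (abs_add_le _ _).trans (add_le_add (hF.bound p hp) (hG.bound p hp))
  · rw [add_sub_add_comm, add_mul]
    exact (abs_add_le _ _).trans (add_le_add (hF.lipschitz _ _ _ hp hp') (hG.lipschitz _ _ _ hp hp'))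

theorem XLip.neg {F : ℝ × ℝ → ℝ} {B : ℝ} (hF : XLip F B) : XLip (fun p => -F p) B := by
  refine ⟨hF.continuousOn.neg, fun p hp => ?_, fun x x' y hp hp' => ?_⟩
  · rw [abs_neg]; exact hF.bound p hp
  · rw [neg_sub_neg, abs_sub_comm]; exact hF.lipschitz _ _ _ hp hp'

/-- `a` holds the coefficients of the restrictions of a Morley function to the cells. -/
def IsCoeff (N : ℕ) (ξ : Broken) (a : ℕ → ℕ → Fin 8 → ℝ) : Prop :=
  ∀ i < N, ∀ j < N, ξ i j = morleyPoly (a i j)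

theorem IsMorley.exists_isCoeff {X : ℕ → ℝ} {N : ℕ} {ξ : Broken} (h : IsMorley X N ξ) :
    ∃ a, IsCoeff N ξ a := by
  have := h.poly
  choose! a ha using this
  exact ⟨a, fun i hi j hj => funext fun q => ha i hi j hj q.1 q.2⟩

/-! ### The two estimates on a two-jump mesh -/

section Estimates

variable {X : ℕ → ℝ} {N n m : ℕ} {δ ε : ℝ} {ξ : Broken} {a : ℕ → ℕ → Fin 8 → ℝ}

theorem sqrt_meshIntegral_dx_le (ha : IsCoeff N ξ a) :
    Real.sqrt (meshIntegral X N fun i j q =>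
      (quad (a i j 1) (a i j 3) (a i j 6) q.1 + a i j 4 * q.2) ^ 2) ≤ energyNorm X N ε ξ ∧
    Real.sqrt (meshIntegral X N fun i j q =>
      (quad (a i j 2) (a i j 5) (a i j 7) q.2 + a i j 4 * q.1) ^ 2) ≤ energyNorm X N ε ξ := by
  have h1 : semi1Sq X N ξ = meshIntegral X N (fun i j q =>
      (quad (a i j 1) (a i j 3) (a i j 6) q.1 + a i j 4 * q.2) ^ 2)
      + meshIntegral X N fun i j q =>
      (quad (a i j 2) (a i j 5) (a i j 7) q.2 + a i j 4 * q.1) ^ 2 := by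
    rw [← meshIntegral_add]
    · exact meshIntegral_congr fun i hi j hj q _ => by
        simp only [ha i hi j hj, dx_morleyPoly, dy_morleyPoly]
    · exact fun i _ j _ => integrableOn_cell_of_continuous X i j (by unfold quad; fun_prop)
    · exact fun i _ j _ => integrableOn_cell_of_continuous X i j (by unfold quad; fun_prop)
  have h2 : 0 ≤ ε ^ 2 * semi2Sq X N ξ :=
    mul_nonneg (sq_nonneg _) (meshIntegral_nonneg fun _ _ _ => sq_nonneg _)
  constructor <;> refine Real.sqrt_le_sqrt ?_ <;> rw [h1]
  · have := meshIntegral_nonneg (X := X) (N := N) (g := fun i j q =>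
      (quad (a i j 2) (a i j 5) (a i j 7) q.2 + a i j 4 * q.1) ^ 2) fun _ _ _ => sq_nonneg _
    linarith
  · have := meshIntegral_nonneg (X := X) (N := N) (g := fun i j q =>
      (quad (a i j 1) (a i j 3) (a i j 6) q.1 + a i j 4 * q.2) ^ 2) fun _ _ _ => sq_nonneg _
    linarith

theorem abs_meshIntegral_xbub_le (hX : IsTwoJumpMesh X N n m δ) (hN : 0 < N) (hδ : 0 ≤ δ)
    (hδ1 : δ ≤ 1) (hξ : IsMorley X N ξ) (ha : IsCoeff N ξ a) {F : ℝ × ℝ → ℝ} {B : ℝ}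
    (hF : XLip F B) :
    |meshIntegral X N fun i j q => F q * bub (X i) (X (i + 1)) (a i j 3) (a i j 6) q.1|
      ≤ 8 * B * δ ^ 3 * energyNorm X N ε ξ := by
  have hB := hF.nonneg
  refine (abs_meshIntegral_mul_bub_le hX hN hδ hδ1 hB hF.continuousOn hF.bound hF.lipschitz
    (fun i j => a i j 1) (fun i j => a i j 3) (fun i j => a i j 6) (fun i j => a i j 4)
    (fun i hi j hj => ?_) (fun j hj => ?_) (fun j hj => ?_)).trans
    (mul_le_mul_of_nonneg_left (sqrt_meshIntegral_dx_le ha).1 (by positivity))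
  · have h := hξ.edge_vert i hi j hj
    rw [ha _ hi _ hj, ha i (by omega) _ hj, vertFlux_morleyPoly (hX.lt j hj).le,
      vertFlux_morleyPoly (hX.lt j hj).le, ← mul_sub] at h
    exact sub_eq_zero.1 ((mul_eq_zero.1 h).resolve_left (sub_pos.2 (hX.lt j hj)).ne')
  · have h := hξ.edge_left j hj
    rw [ha _ hN _ hj, vertFlux_morleyPoly (hX.lt j hj).le] at h
    exact (mul_eq_zero.1 h).resolve_left (sub_pos.2 (hX.lt j hj)).ne'
  · have h := hξ.edge_right j hj
    rw [ha _ (by omega) _ hj, vertFlux_morleyPoly (hX.lt j hj).le] at h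
    exact (mul_eq_zero.1 h).resolve_left (sub_pos.2 (hX.lt j hj)).ne'

/-- The `x`-direction estimate for the transposed function: indices are exchanged and horizontal
edges play the role of vertical ones. -/
theorem abs_meshIntegral_ybub_le (hX : IsTwoJumpMesh X N n m δ) (hN : 0 < N) (hδ : 0 ≤ δ)
    (hδ1 : δ ≤ 1) (hξ : IsMorley X N ξ) (ha : IsCoeff N ξ a) {F : ℝ × ℝ → ℝ} {B : ℝ}
    (hF : XLip F B) :
    |meshIntegral X N fun i j q => F q * bub (X i) (X (i + 1)) (a j i 5) (a j i 7) q.1|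
      ≤ 8 * B * δ ^ 3 * energyNorm X N ε ξ := by
  have hB := hF.nonneg
  have hG := (sqrt_meshIntegral_dx_le (X := X) (ε := ε) ha).2
  rw [meshIntegral_swap] at hG
  refine (abs_meshIntegral_mul_bub_le hX hN hδ hδ1 hB hF.continuousOn hF.bound hF.lipschitz
    (fun i j => a j i 2) (fun i j => a j i 5) (fun i j => a j i 7) (fun i j => a j i 4)
    (fun i hi j hj => ?_) (fun j hj => ?_) (fun j hj => ?_)).trans
    (mul_le_mul_of_nonneg_left hG (by positivity))
  · have h := hξ.edge_hor j hj i hi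
    rw [ha _ hj _ hi, ha _ hj i (by omega), horFlux_morleyPoly (hX.lt j hj).le,
      horFlux_morleyPoly (hX.lt j hj).le, ← mul_sub] at h
    exact sub_eq_zero.1 ((mul_eq_zero.1 h).resolve_left (sub_pos.2 (hX.lt j hj)).ne')
  · have h := hξ.edge_bottom j hj
    rw [ha _ hj _ hN, horFlux_morleyPoly (hX.lt j hj).le] at h
    exact (mul_eq_zero.1 h).resolve_left (sub_pos.2 (hX.lt j hj)).ne'
  · have h := hξ.edge_top j hj
    rw [ha _ hj _ (by omega), horFlux_morleyPoly (hX.lt j hj).le] at h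
    exact (mul_eq_zero.1 h).resolve_left (sub_pos.2 (hX.lt j hj)).ne'

theorem sub_interp_eq (hX : IsTwoJumpMesh X N n m δ) (ha : IsCoeff N ξ a) {i j : ℕ} (hi : i < N)
    (hj : j < N) : (ξ - interp X ξ) i j = fun q =>
      bub (X i) (X (i + 1)) (a i j 3) (a i j 6) q.1
        + bub (X j) (X (j + 1)) (a i j 5) (a i j 7) q.2 := by
  funext q
  rw [Pi.sub_apply, Pi.sub_apply, Pi.sub_apply, interp, ha i hi j hj]
  exact morleyPoly_sub_bilin _ (hX.lt i hi) (hX.lt j hj) q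

/-- The interpolation error tested with a smooth load. -/
theorem abs_l2Form_sub_interp_le (hX : IsTwoJumpMesh X N n m δ) (hN : 0 < N) (hδ : 0 ≤ δ)
    (hδ1 : δ ≤ 1) (hξ : IsMorley X N ξ) {f : ℝ × ℝ → ℝ} {M : ℝ} (hf : CkBound 1 f M) :
    |l2Form X N f (ξ - interp X ξ)| ≤ 16 * M * δ ^ 3 * energyNorm X N ε ξ := by
  obtain ⟨a, ha⟩ := hξ.exists_isCoeff
  have hfx := hf.xReg.xLip
  have h1 := abs_meshIntegral_xbub_le (ε := ε) hX hN hδ hδ1 hξ ha hfx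
  have h2 := abs_meshIntegral_ybub_le (ε := ε) hX hN hδ hδ1 hξ ha hf.xReg_swap.xLip
  rw [meshIntegral_swap] at h2
  have h3 : l2Form X N f (ξ - interp X ξ)
      = meshIntegral X N (fun i j q => f q * bub (X i) (X (i + 1)) (a i j 3) (a i j 6) q.1)
        + meshIntegral X N
          (fun i j q => f q * bub (X j) (X (j + 1)) (a i j 5) (a i j 7) q.2) := by
    rw [← meshIntegral_add]
    · exact meshIntegral_congr fun i hi j hj q _ => by
        simp only [sub_interp_eq hX ha hi hj]; ring
    · exact fun i hi j hj => integrableOn_cell (hX.cell_subset hi hj) hfx.continuousOn hfx.bound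
        ((continuous_bub _ _ _ _).comp continuous_fst)
    · exact fun i hi j hj => integrableOn_cell (hX.cell_subset hi hj) hfx.continuousOn hfx.bound
        ((continuous_bub _ _ _ _).comp continuous_snd)
  rw [h3]
  refine (abs_add_le _ _).trans ((add_le_add h1 h2).trans_eq (by ring))

/-- Integration by parts turns the `x`-part of the convection form into a load term. -/
theorem exists_xLip_parts (hX : IsTwoJumpMesh X N n m δ) {c S : ℝ × ℝ → ℝ} {M : ℝ}
    (hc : XReg 2 c M) (hS : XReg 3 S M) : ∃ F, XLip F (4 * M ^ 2) ∧ ∀ s t : ℕ → ℕ → ℝ,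
      meshIntegral X N (fun i j q =>
        (c q * dx S q) * bubDeriv (X i) (X (i + 1)) (s i j) (t i j) q.1)
      = meshIntegral X N (fun i j q => F q * bub (X i) (X (i + 1)) (s i j) (t i j) q.1) := by
  have hcS := hc.xLip.mul hS.deriv.xLip
  -- The new load is `-∂(c ∂S/∂x)/∂x`. Its two products each contribute `2 M²` to the bound.
  have hD := (hc.deriv.xLip.mul hS.deriv.xLip).add (hc.xLip.mul hS.deriv.deriv.xLip)
  have hD' := hD.neg
  rw [show 2 * M ^ 2 + 2 * M ^ 2 = 4 * M ^ 2 by ring] at hD'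
  refine ⟨_, hD', fun s t => ?_⟩
  refine Finset.sum_congr rfl fun i hi => Finset.sum_congr rfl fun j hj => ?_
  have hi := Finset.mem_range.1 hi
  have hj := Finset.mem_range.1 hj
  exact integral_mul_bubDeriv (hX.lt i hi) (hX.cell_subset hi hj) hcS.continuousOn hcS.bound
    hD.continuousOn hD.bound
    (fun x y hp => (hc.hasDerivAt hp).mul (hS.deriv.hasDerivAt hp)) _ _

/-- The interpolation error in the convection form. -/
theorem abs_bForm_sub_interp_le (hX : IsTwoJumpMesh X N n m δ) (hN : 0 < N) (hδ : 0 ≤ δ)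
    (hδ1 : δ ≤ 1) (hξ : IsMorley X N ξ) {c S : ℝ × ℝ → ℝ} {M : ℝ} (hc : CkBound 2 c M)
    (hS : CkBound 4 S M) :
    |bForm X N c (fun _ _ => S) (ξ - interp X ξ)| ≤ 64 * M ^ 2 * δ ^ 3 * energyNorm X N ε ξ := by
  obtain ⟨a, ha⟩ := hξ.exists_isCoeff
  have hSx : XReg 3 S M := hS.xReg.mono (by norm_num)
  have hSy : XReg 3 (S ∘ Prod.swap) M := hS.xReg_swap.mono (by norm_num)
  have hx := hc.xReg.xLip.mul hSx.deriv.xLip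
  have hy := hc.xReg_swap.xLip.mul hSy.deriv.xLip
  obtain ⟨F, hF, hFe⟩ := exists_xLip_parts hX hc.xReg hSx
  obtain ⟨G, hG, hGe⟩ := exists_xLip_parts hX hc.xReg_swap hSy
  have h1 := abs_meshIntegral_xbub_le (ε := ε) hX hN hδ hδ1 hξ ha hF
  have h2 := abs_meshIntegral_ybub_le (ε := ε) hX hN hδ hδ1 hξ ha hG
  rw [← hFe (fun i j => a i j 3) (fun i j => a i j 6)] at h1
  rw [← hGe (fun i j => a j i 5) (fun i j => a j i 7), meshIntegral_swap] at h2
  -- By definition, `dx (S ∘ Prod.swap)` at the swapped point is `dy S`.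
  have hyc : ContinuousOn (fun p => c p * dy S p) Om :=
    hy.continuousOn.comp (continuous_swap.continuousOn (s := Om)) fun p hp => ⟨hp.2, hp.1⟩
  have hyb : ∀ p ∈ Om, |c p * dy S p| ≤ 2 * M ^ 2 := fun p hp => hy.bound p.swap ⟨hp.2, hp.1⟩
  have h3 : bForm X N c (fun _ _ => S) (ξ - interp X ξ)
      = meshIntegral X N (fun i j q =>
          (c q * dx S q) * bubDeriv (X i) (X (i + 1)) (a i j 3) (a i j 6) q.1)
        + meshIntegral X N (fun i j q =>
          (c q * dy S q) * bubDeriv (X j) (X (j + 1)) (a i j 5) (a i j 7) q.2) := by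
    rw [← meshIntegral_add]
    · refine meshIntegral_congr fun i hi j hj q _ => ?_
      have ex : dx ((ξ - interp X ξ) i j) q
          = bubDeriv (X i) (X (i + 1)) (a i j 3) (a i j 6) q.1 := by
        rw [sub_interp_eq hX ha hi hj, dx]
        exact ((hasDerivAt_bub (X i) (X (i + 1)) (a i j 3) (a i j 6) q.1).add_const
          (bub (X j) (X (j + 1)) (a i j 5) (a i j 7) q.2)).deriv
      have ey : dy ((ξ - interp X ξ) i j) q
          = bubDeriv (X j) (X (j + 1)) (a i j 5) (a i j 7) q.2 := by
        rw [sub_interp_eq hX ha hi hj, dy]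
        exact ((hasDerivAt_bub (X j) (X (j + 1)) (a i j 5) (a i j 7) q.2).const_add
          (bub (X i) (X (i + 1)) (a i j 3) (a i j 6) q.1)).deriv
      rw [ex, ey]; ring
    · exact fun i hi j hj => integrableOn_cell (hX.cell_subset hi hj) hx.continuousOn hx.bound
        ((continuous_bubDeriv _ _ _ _).comp continuous_fst)
    · exact fun i hi j hj => integrableOn_cell (hX.cell_subset hi hj) hyc hyb
        ((continuous_bubDeriv _ _ _ _).comp continuous_snd)
  rw [h3]
  refine (abs_add_le _ _).trans ((add_le_add h1 h2).trans_eq (by ring))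

end Estimates

theorem exists_mesh_parameter {ε : ℝ} (hε : 0 < ε) {N : ℕ} (hN : 0 < N) (h4 : 4 ∣ N) :
    ∃ n m δ, IsTwoJumpMesh (node ε N) N n m δ ∧ 0 ≤ δ ∧ δ ≤ 1
      ∧ δ ^ 3 = (N : ℝ) ^ (-(3 / 2 : ℝ)) := by
  obtain ⟨k, rfl⟩ := h4
  have hNpos : (0 : ℝ) < (4 * k : ℕ) := by exact_mod_cast hN
  have hN1 : (1 : ℝ) ≤ (4 * k : ℕ) := by exact_mod_cast hN
  -- The choice `δ = N^(-1/2)` makes the step bound `2 δ²` equal to `2 / N`.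
  refine ⟨k, 3 * k, ((4 * k : ℕ) : ℝ) ^ (-(1 / 2) : ℝ), isTwoJumpMesh_node hε (by omega) ?_,
    by positivity, Real.rpow_le_one_of_one_le_of_nonpos hN1 (by norm_num), ?_⟩
  · rw [← Real.rpow_natCast, ← Real.rpow_mul hNpos.le]
    norm_num [Real.rpow_neg_one]
  · rw [← Real.rpow_natCast, ← Real.rpow_mul hNpos.le]
    norm_num

end Morley

theorem lemma4p7 :
    (∀ M : ℝ, ∃ C : ℝ, 0 < C ∧
      ∀ c S : ℝ × ℝ → ℝ, Morley.CkBound 2 c M → Morley.CkBound 4 S M →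
      ∀ ε : ℝ, 0 < ε → ∀ N : ℕ, 0 < N → 4 ∣ N →
      ∀ ξ : Morley.Broken, Morley.IsMorley (Morley.node ε N) N ξ →
        |Morley.bForm (Morley.node ε N) N c (fun _ _ => S)
            (ξ - Morley.interp (Morley.node ε N) ξ)|
          ≤ C * (N : ℝ) ^ (-(3 / 2 : ℝ)) * Morley.energyNorm (Morley.node ε N) N ε ξ) ∧
    (∀ M : ℝ, ∃ C : ℝ, 0 < C ∧
      ∀ f : ℝ × ℝ → ℝ, Morley.CkBound 1 f M →
      ∀ ε : ℝ, 0 < ε → ∀ N : ℕ, 0 < N → 4 ∣ N →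
      ∀ ξ : Morley.Broken, Morley.IsMorley (Morley.node ε N) N ξ →
        |Morley.l2Form (Morley.node ε N) N f (ξ - Morley.interp (Morley.node ε N) ξ)|
          ≤ C * (N : ℝ) ^ (-(3 / 2 : ℝ)) * Morley.energyNorm (Morley.node ε N) N ε ξ) := by
  -- Each direction contributes `8 B`, with `B = 4 M²` for the form and `B = M` for the load; `+ 1`
  -- and `|M|` only secure positivity.
  refine ⟨fun M => ⟨64 * M ^ 2 + 1, by positivity, fun c S hc hS ε hε N hN h4 ξ hξ => ?_⟩,
    fun M => ⟨16 * |M| + 1, by positivity, fun f hf ε hε N hN h4 ξ hξ => ?_⟩⟩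
  · obtain ⟨n, m, δ, hX, hδ, hδ1, hδN⟩ := Morley.exists_mesh_parameter hε hN h4
    rw [← hδN]
    refine (Morley.abs_bForm_sub_interp_le (ε := ε) hX hN hδ hδ1 hξ hc hS).trans ?_
    have : 0 ≤ Morley.energyNorm (Morley.node ε N) N ε ξ := Real.sqrt_nonneg _
    gcongr
    linarith
  · obtain ⟨n, m, δ, hX, hδ, hδ1, hδN⟩ := Morley.exists_mesh_parameter hε hN h4
    rw [← hδN]
    refine (Morley.abs_l2Form_sub_interp_le (ε := ε) hX hN hδ hδ1 hξ hf).trans ?_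
    have : 0 ≤ Morley.energyNorm (Morley.node ε N) N ε ξ := Real.sqrt_nonneg _
    gcongr
    linarith [le_abs_self M]
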